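/- **Setting.** Let $q\in\{0,1\}$ and let $L$ be holomorphic on $\mathbb C\setminus\{1\}$, with a simple pole at $1$ if $q=1$ and holomorphic at $1$ if $q=0$. Assume that $L$ has no zero in $\{\mathrm{Re}\,z>1\}$ and that, for all $n,N\in\mathbb N$, $(\log L)^{(n)}(x)=O(x^{-N})$ as $x\to+\infty$ along the real axis. Assume that there are entire functions $\mathbf G,\Xi$, both of order $1$, with $\mathbf G(z)\,\Xi(z)=(z-1)^qL(z)$ and $\Xi(z)=\Xi(1-z)$, such that all zeros of $\mathbf G$ lie in $\{\mathrm{Re}\,z\le 0\}$ and all zeros $\rho$ of $\Xi$ lie in $\{0<\mathrm{Re}\,z<1\}$ and are non-real. Assume finally that, as $x\to+\infty$, $$-\log\mathbf G(x)\sim \tilde a_1x(\log x-1)+b_1x+\tilde a_0\log x+b_0+\sum_{n\ge1}a_{-n}x^{-n},$$ for a holomorphic branch of $\log\mathbf G$ in $\{\mathrm{Re}\,z>0\}$, the expansion being indefinitely differentiable term by term. Powers are taken with their principal determination on $\mathbb C\setminus(-\infty,0]$. **(1)** Let $x\in\mathbb C\setminus(-\infty,1]$ be such that $x-z\notin(-\infty,0]$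 for every zero $z$ of $L$. Then the integral $$\mathscr J(s,x)=\int_0^\infty \frac{L'}{L}(x+y)\,y^{-s}\,dy$$ converges absolutely for $\mathrm{Re}\,s<1$, and $s\mapsto\mathscr J(s,x)$ extends to a meromorphic function on $\mathbb C$ that is holomorphic away from $s=1,2,3,\dots$ and has at each $s=n\ge1$ at most a simple pole, with residue $$\mathrm{Res}_{s=n}\mathscr J(s,x)=-\frac{(\log|L|)^{(n)}(x)}{(n-1)!},$$ the pole being present (and simple) whenever this number is nonzero. Here, for complex $x$, $(\log|L|)^{(n)}(x)$ denotes $(L'/L)^{(n-1)}(x)$, the $n$-th derivative of any local branch of $\log L$; if $L$ is real-valued on $(1,\infty)$, then for real $x>1$ this is the ordinary $n$-th derivative of $\log|L|$. **(2)** Let $x\in\mathbb C$ be such that $x-\rho\notin(-\infty,0]$ for every zero $\rho$ of $\Xi$. Then the series $$\mathscr Z(s,x)=\sum_\rho(x-\rho)^{-s},$$ over the zeros of $\Xi$ counted with multiplicity, converges absolutely for $\mathrm{Re}\,s>1$, and $s\mapsto\mathscr Z(s,x)$ extends to a meromorphic function on $\mathbb C$ that is holomorphic away from $s=1$, and has at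 $s=1$ at most a simple pole, with residue $-\tilde a_1$ (a genuine simple pole if $\tilde a_1\ne0$). -/

import Mathlib

open Filter Topology Asymptotics

/-- `f` is an entire function whose order of growth (the infimum of the `a ≥ 0` with
`f(z) = O(exp |z|^a)` as `|z| → ∞`) is equal to `μ`. -/
def IsEntireOfOrder (f : ℂ → ℂ) (μ : ℝ) : Prop :=
  Differentiable ℂ f ∧
  (∀ a : ℝ, μ < a → f =O[Bornology.cobounded ℂ] fun z : ℂ => Real.exp (‖z‖ ^ a)) ∧
  (∀ a : ℝ, 0 ≤ a → a < μ → ¬ f =O[Bornology.cobounded ℂ] fun z : ℂ => Real.exp (‖z‖ ^ a))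

/-- `L` is a primary zeta or `L`-function with trivial factor `G`, completed function `Ξ`, and a
pole of order `q ∈ {0, 1}` at `1`. The equation `Ξ(z) = G(z)⁻¹ (z - 1)^q L(z)` is written in the
multiplied form `G(z) Ξ(z) = (z - 1)^q L(z)`, which determines the entire function `Ξ`. -/
structure IsPrimaryFunction (L G Ξ : ℂ → ℂ) (q : ℕ) : Prop where
  /-- `q` is `0` or `1` -/
  q_le_one : q ≤ 1
  /-- `L` is holomorphic away from `1` -/
  analyticAt : ∀ z : ℂ, z ≠ 1 → AnalyticAt ℂ L z
  /-- for `q = 0`, `L` has no pole at all -/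
  analyticAt_one : q = 0 → AnalyticAt ℂ L 1
  /-- for `q = 1`, `L` has a simple pole at `1` -/
  pole_one : q = 1 → meromorphicOrderAt L 1 = -1
  /-- `L` does not vanish to the right of the critical strip -/
  ne_zero : ∀ z : ℂ, 1 < z.re → L z ≠ 0
  /-- `log L` and all its derivatives are `O(x^(-∞))` as `x → +∞` along the real axis. (Since
  `log L(x) → 0`, the branch of `log L` is the principal one for large `x`.) -/
  log_decay : ∀ n N : ℕ,
    (fun x : ℝ => iteratedDeriv n (fun z : ℂ => Complex.log (L z)) (x : ℂ))
      =O[atTop] fun x : ℝ => x ^ (-(N : ℤ))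
  /-- `G` is entire of order `1` -/
  order_G : IsEntireOfOrder G 1
  /-- `Ξ` is entire of order `1` -/
  order_Xi : IsEntireOfOrder Ξ 1
  /-- definition of `Ξ` -/
  factor : ∀ z : ℂ, z ≠ 1 → G z * Ξ z = (z - 1) ^ q * L z
  /-- functional equation -/
  functional_equation : ∀ z : ℂ, Ξ z = Ξ (1 - z)
  /-- the zeros of `G` (the trivial zeros) lie in the closed left half-plane -/
  zeros_G : ∀ z : ℂ, G z = 0 → z.re ≤ 0
  /-- the zeros of `Ξ` (the nontrivial zeros) lie in the open critical strip -/
  zeros_Xi : ∀ z : ℂ, Ξ z = 0 → 0 < z.re ∧ z.re < 1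
  /-- there are no real nontrivial zeros -/
  zeros_Xi_not_real : ∀ z : ℂ, Ξ z = 0 → z.im ≠ 0

/-- The generalized Stirling expansion, as `x → +∞` along the real axis,
`-log G(x) ∼ a₁ x (log x - 1) + b₁ x + a₀ log x + b₀ + ∑_{n ≥ 1} a(n) x^(-n)`,
differentiable term by term any number of times. Here `ℓ` is a holomorphic branch of `log G` in
the right half-plane. -/
def HasStirlingExpansion (G : ℂ → ℂ) (a₁ b₁ a₀ b₀ : ℂ) (a : ℕ → ℂ) : Prop :=
  ∃ ℓ : ℂ → ℂ,
    DifferentiableOn ℂ ℓ {z : ℂ | 0 < z.re} ∧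
    (∀ z : ℂ, 0 < z.re → Complex.exp (ℓ z) = G z) ∧
    ∀ N k : ℕ,
      (fun x : ℝ => iteratedDeriv k
        (fun z : ℂ => -ℓ z - (a₁ * z * (Complex.log z - 1) + b₁ * z + a₀ * Complex.log z + b₀
          + ∑ n ∈ Finset.Icc 1 N, a n * z ^ (-(n : ℤ)))) (x : ℂ))
        =O[atTop] fun x : ℝ => x ^ (-((N + 1 + k : ℕ) : ℤ))

/-- The term of the zero `ρ` of `Ξ` in the zeta function over the zeros, repeated according to
its multiplicity: `m(ρ) (x - ρ)^(-s)`, with the principal determination of the power. -/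
noncomputable def zeroZetaTerm (Ξ : ℂ → ℂ) (s x : ℂ) (ρ : {ρ : ℂ // Ξ ρ = 0}) : ℂ :=
  (analyticOrderNatAt Ξ (ρ : ℂ) : ℂ) * (x - (ρ : ℂ)) ^ (-s)

/-- `𝒵(s, x) = ∑_ρ (x - ρ)^(-s)` over the zeros of `Ξ`, counted with multiplicity. -/
noncomputable def zeroZeta (Ξ : ℂ → ℂ) (s x : ℂ) : ℂ :=
  ∑' ρ : {ρ : ℂ // Ξ ρ = 0}, zeroZetaTerm Ξ s x ρ

/-- The integrand `(L'/L)(x + y) y^(-s)`. -/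
noncomputable def mellinIntegrand (L : ℂ → ℂ) (s x : ℂ) (y : ℝ) : ℂ :=
  logDeriv L (x + (y : ℂ)) * (y : ℂ) ^ (-s)

/-- `𝒥(s, x) = ∫_0^∞ (L'/L)(x + y) y^(-s) dy`. -/
noncomputable def mellinJ (L : ℂ → ℂ) (s x : ℂ) : ℂ :=
  ∫ y in Set.Ioi (0 : ℝ), mellinIntegrand L s x y

/-- The `n`-th derivative (`n ≥ 1`) of `log L` at the complex point `x`, for any local branch of
the logarithm, namely `(L'/L)^(n-1)(x)`. -/
noncomputable def logDerivN (L : ℂ → ℂ) (n : ℕ) (x : ℂ) : ℂ :=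
  iteratedDeriv (n - 1) (logDeriv L) x

/-- Near `z` one has `f(s) = r / (s - z) + (holomorphic)`: a simple pole of residue `r` if
`r ≠ 0`, and no pole (a removable singularity) if `r = 0`. -/
def HasSimplePolarPart (f : ℂ → ℂ) (z r : ℂ) : Prop :=
  ∃ g : ℂ → ℂ, AnalyticAt ℂ g z ∧ ∀ᶠ s in 𝓝[≠] z, f s = r / (s - z) + g s

/-!
Both continuations come from Mellin transforms. If `f` has an expansion `∑ c k * t ^ k` at `0⁺` and
decays at infinity, `∫ f(t) t ^ (s - 1) dt` continues to the left with at most simple poles at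
`s = -k`, of residue `c k` (`exists_mellin_continuation`).

For `𝒥(s, x)`, this applies to `f(y) = (L'/L)(x + y)` at `1 - s`: the expansion at `0` is the Taylor
series, and what is needed is rapid decay on the line `x + ℝ`. The decay of `log L` is known only on
the real axis. It spreads to horizontal lines (`eventually_norm_le_of_iteratedDeriv_isBigO`) since
`L'/L` grows at most polynomially on discs `B(u, u/8)`, by the Borel–Carathéodory inequality and the
finite order of `G` and `Ξ`: the first Taylor coefficients at `u` are small, and the others are
controlled by Cauchy's estimates.

For `𝒵(s, x)`, the identity `∫ (w + y)⁻² y ^ (1 - s) dy = w ^ (-s) Γ(s) Γ(2 - s)`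
(`mellin_inv_add_sq`), summed over `w = x - ρ`, gives for `1 < Re s < 2`
`Γ(s) Γ(2 - s) 𝒵(s, x) = -∫ (Ξ'/Ξ)'(x + y) y ^ (1 - s) dy` (`mellin_deriv_logDeriv_eq`). This uses
`-(Ξ'/Ξ)'(z) = ∑ (z - ρ)⁻²` (`hasSum_zeros_inv_sq`), proved by dividing `Ξ` by the polynomial of its
zeros in a large disc and estimating the logarithm of the quotient, which avoids Hadamard's
factorisation. From `G Ξ = (z - 1)^q L`, the Stirling expansion of `log G` (carried over to
horizontal lines as above) and the decay of `L'/L`, the function `(Ξ'/Ξ)'(x + y)` has an expansion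
in powers of `1 / y` with leading term `a₁ / y`. After the substitution `t = 1 / y` the Mellin
transform continues to `Re s < 2` with simple poles at most at `s = 1, 0, -1, …`; the residue at `1`
is `-a₁`, and the other poles are cancelled by the zeros of `1 / Γ(s)`.
-/

/-! ### Logarithmic derivatives of zero-free functions -/

/-- A zero-free holomorphic function on a ball, normalised at the centre, has a holomorphic
logarithm, which the Borel–Carathéodory inequality bounds in terms of `log ‖g‖`. -/
theorem exists_primitive_logDeriv_norm_le {g : ℂ → ℂ} {c : ℂ} {R A : ℝ} (hR : 0 < R) (hA : 0 < A)
    (hg : DifferentiableOn ℂ g (Metric.ball c R)) (h0 : ∀ w ∈ Metric.ball c R, g w ≠ 0)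
    (hb : ∀ w ∈ Metric.ball c R, ‖g w‖ ≤ Real.exp A * ‖g c‖) :
    ∃ p : ℂ → ℂ, (∀ w ∈ Metric.ball c R, HasDerivAt p (logDeriv g w) w) ∧
      ∀ w ∈ Metric.ball c (R / 2), ‖p w‖ ≤ 2 * A := by
  have hld : DifferentiableOn ℂ (logDeriv g) (Metric.ball c R) :=
    (hg.deriv Metric.isOpen_ball).div hg h0
  obtain ⟨p, hpc, hp⟩ := hld.isExactOn_ball.with_val_at c 0
  have hcm : c ∈ Metric.ball c R := Metric.mem_ball_self hR
  have hgc : g c ≠ 0 := h0 c hcm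
  refine ⟨p, hp, ?_⟩
  have hexp : ∀ w ∈ Metric.ball c R, g w = g c * Complex.exp (p w) := by
    have hd : ∀ w ∈ Metric.ball c R, HasDerivAt (fun w => g w * Complex.exp (-p w)) 0 w := by
      intro w hw
      have h1 := (hg.differentiableAt (Metric.isOpen_ball.mem_nhds hw)).hasDerivAt
      have h2 := h1.mul ((hp w hw).neg.cexp)
      have h3 : deriv g w * Complex.exp (-p w) +
          g w * (Complex.exp (-p w) * -logDeriv g w) = 0 := by
        have := h0 w hw
        rw [logDeriv_apply]
        field_simp
        ring
      exact h3 ▸ h2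
    have hconst : ∀ w ∈ Metric.ball c R,
        g w * Complex.exp (-p w) = g c * Complex.exp (-p c) := by
      intro w hw
      exact Metric.isOpen_ball.is_const_of_deriv_eq_zero (convex_ball c R).isPreconnected
        (fun z hz => (hd z hz).differentiableAt.differentiableWithinAt)
        (fun z hz => (hd z hz).deriv) hw hcm
    intro w hw
    have := hconst w hw
    rw [hpc, neg_zero, Complex.exp_zero, mul_one] at this
    rw [← this, mul_assoc, ← Complex.exp_add, neg_add_cancel, Complex.exp_zero, mul_one]
  have hre : ∀ w ∈ Metric.ball c R, (p w).re ≤ A := by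
    intro w hw
    have h1 := hb w hw
    rw [hexp w hw, norm_mul, Complex.norm_exp, mul_comm] at h1
    exact Real.exp_le_exp.1 (le_of_mul_le_mul_right h1 (norm_pos_iff.2 hgc))
  intro w hw
  have hw' : ‖w - c‖ < R / 2 := by rwa [mem_ball_iff_norm] at hw
  have key := Complex.borelCaratheodory_zero (f := fun u => p (c + u)) (z := w - c) (R := R) hA
    ?_ ?_ hR (by rw [mem_ball_zero_iff]; linarith) (by simpa using hpc)
  · simp only [add_sub_cancel] at key
    refine key.trans ?_
    rw [div_le_iff₀ (by linarith)]
    nlinarith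
  · intro u hu
    have : c + u ∈ Metric.ball c R := by simpa [mem_ball_iff_norm] using hu
    exact ((hp _ this).differentiableAt.comp u
      (by fun_prop : DifferentiableAt ℂ (fun u => c + u) u)).differentiableWithinAt
  · intro u hu
    exact hre _ (by simpa [mem_ball_iff_norm] using hu)

/-- Bounds on the first two derivatives of `log g` for a zero-free function on a ball of radius
`R` on which `‖g‖ ≤ exp A ‖g c‖`. -/
theorem norm_logDeriv_le_of_ball {g : ℂ → ℂ} {c : ℂ} {R A : ℝ} (hR : 0 < R) (hA : 0 < A)
    (hg : DifferentiableOn ℂ g (Metric.ball c R)) (h0 : ∀ w ∈ Metric.ball c R, g w ≠ 0)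
    (hb : ∀ w ∈ Metric.ball c R, ‖g w‖ ≤ Real.exp A * ‖g c‖) {w : ℂ} (hw : ‖w - c‖ ≤ R / 4) :
    ‖logDeriv g w‖ ≤ 16 * A / R ∧ ‖deriv (logDeriv g) w‖ ≤ 256 * A / R ^ 2 := by
  obtain ⟨p, hp, hpb⟩ := exists_primitive_logDeriv_norm_le hR hA hg h0 hb
  have hsub : Metric.closedBall w (R / 8) ⊆ Metric.ball c (R / 2) := by
    intro u hu
    rw [mem_closedBall_iff_norm] at hu
    rw [mem_ball_iff_norm]
    calc ‖u - c‖ ≤ ‖u - w‖ + ‖w - c‖ := norm_sub_le_norm_sub_add_norm_sub _ _ _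
      _ < R / 2 := by linarith
  have hsub' : Metric.ball c (R / 2) ⊆ Metric.ball c R := Metric.ball_subset_ball (by linarith)
  have hcl : DiffContOnCl ℂ p (Metric.ball w (R / 8)) := by
    refine DifferentiableOn.diffContOnCl_ball (U := Metric.ball c (R / 2)) ?_ hsub
    exact fun u hu => (hp u (hsub' hu)).differentiableAt.differentiableWithinAt
  have hC : ∀ z ∈ Metric.sphere w (R / 8), ‖p z‖ ≤ 2 * A :=
    fun z hz => hpb z (hsub (Metric.sphere_subset_closedBall hz))
  have h1 := Complex.norm_iteratedDeriv_le_of_forall_mem_sphere_norm_le 1 (by positivity) hcl hC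
  have h2 := Complex.norm_iteratedDeriv_le_of_forall_mem_sphere_norm_le 2 (by positivity) hcl hC
  have hwm : w ∈ Metric.ball c R :=
    hsub' (hsub (Metric.mem_closedBall_self (by positivity)))
  have hev : deriv p =ᶠ[𝓝 w] logDeriv g := by
    filter_upwards [Metric.isOpen_ball.mem_nhds hwm] with u hu using (hp u hu).deriv
  rw [iteratedDeriv_one, hev.eq_of_nhds] at h1
  rw [iteratedDeriv_succ, iteratedDeriv_one, hev.deriv_eq] at h2
  constructor
  · refine h1.trans (le_of_eq ?_)
    simp; field_simp; norm_num
  · refine h2.trans (le_of_eq ?_)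
    simp [Nat.factorial]; field_simp; norm_num

/-! ### From the real axis to horizontal lines -/

/-- If `f` grows at most polynomially on balls `B(x, x/8)` and all derivatives of `f` are
`O(x ^ (-M))` along the real axis, then `f` is `O(x ^ (-M))` uniformly at bounded distance from the
real axis: the Taylor series of `f` at `x` is truncated where Cauchy's estimates take over. -/
theorem eventually_norm_le_of_iteratedDeriv_isBigO {f : ℂ → ℂ} {C : ℝ} {K M : ℕ}
    (hd : ∀ᶠ x : ℝ in atTop, DifferentiableOn ℂ f (Metric.ball (x : ℂ) (x / 8)))
    (hC : ∀ᶠ x : ℝ in atTop, ∀ w ∈ Metric.ball (x : ℂ) (x / 8), ‖f w‖ ≤ C * x ^ K)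
    (hk : ∀ k : ℕ, (fun x : ℝ => iteratedDeriv k f (x : ℂ))
      =O[atTop] fun x : ℝ => x ^ (-(M : ℤ))) {r : ℝ} (hr : 0 < r) :
    ∃ D : ℝ, ∀ᶠ x : ℝ in atTop, ∀ w : ℂ, ‖w - x‖ ≤ r → ‖f w‖ ≤ D * x ^ (-(M : ℤ)) := by
  set n := K + M with hn
  have hhead : (fun x : ℝ => ∑ k ∈ Finset.range n, ‖iteratedDeriv k f (x : ℂ)‖ * r ^ k)
      =O[atTop] fun x : ℝ => x ^ (-(M : ℤ)) := by
    refine IsBigO.fun_sum fun k _ => ?_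
    simpa [mul_comm] using (hk k).norm_left.const_mul_left (r ^ k)
  obtain ⟨D, hD⟩ := hhead.bound
  refine ⟨D + C * (16 * r) ^ n * 2, ?_⟩
  filter_upwards [hd, hC, hD, eventually_ge_atTop (32 * r), eventually_gt_atTop 0] with
    x hd hC hD hx hx0 w hw
  have hR : 0 < x / 16 := by positivity
  have hsub : Metric.closedBall (x : ℂ) (x / 16) ⊆ Metric.ball (x : ℂ) (x / 8) :=
    Metric.closedBall_subset_ball (by linarith)
  have hC0 : 0 ≤ C * x ^ K :=
    (norm_nonneg _).trans (hC x (Metric.mem_ball_self (by positivity)))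
  have hCau : ∀ k : ℕ, ‖iteratedDeriv k f (x : ℂ)‖ ≤ k.factorial * (C * x ^ K) / (x / 16) ^ k :=
    fun k => Complex.norm_iteratedDeriv_le_of_forall_mem_sphere_norm_le k hR
      (hd.diffContOnCl_ball hsub) fun z hz => hC z (hsub (Metric.sphere_subset_closedBall hz))
  have hwb : w ∈ Metric.ball (x : ℂ) (x / 8) := by
    rw [mem_ball_iff_norm]; linarith
  have hs := Complex.hasSum_taylorSeries_on_ball hd hwb
  set t : ℕ → ℂ := fun k => ((k.factorial : ℂ)⁻¹ • (w - x) ^ k • iteratedDeriv k f (x : ℂ)) with ht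
  have hnt : ∀ k, ‖t k‖ = (k.factorial : ℝ)⁻¹ * (‖w - x‖ ^ k * ‖iteratedDeriv k f (x : ℂ)‖) := by
    intro k
    simp [ht]
  set θ := 16 * r / x with hθ
  have hθ0 : 0 ≤ θ := by positivity
  have hθ1 : θ ≤ 1 / 2 := by rw [hθ, div_le_iff₀ hx0]; linarith
  have htail : ∀ k, ‖t k‖ ≤ C * x ^ K * θ ^ k := by
    intro k
    rw [hnt]
    calc (k.factorial : ℝ)⁻¹ * (‖w - x‖ ^ k * ‖iteratedDeriv k f (x : ℂ)‖)
        ≤ (k.factorial : ℝ)⁻¹ * (r ^ k * (k.factorial * (C * x ^ K) / (x / 16) ^ k)) := by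
          gcongr
          exact hCau k
      _ = C * x ^ K * θ ^ k := by
          have h1 : (k.factorial : ℝ) ≠ 0 := by positivity
          have h2 : θ ^ k = r ^ k / (x / 16) ^ k := by
            rw [hθ, ← div_pow]; congr 1; field_simp
          rw [h2]
          field_simp
  have hgeo : HasSum (fun k => C * x ^ K * θ ^ (k + n)) (C * x ^ K * (θ ^ n * (1 - θ)⁻¹)) := by
    have := (hasSum_geometric_of_lt_one hθ0 (by linarith)).mul_left (C * x ^ K * θ ^ n)
    simpa only [pow_add, mul_assoc, mul_comm, mul_left_comm] using this
  have hsplit : f w = ∑ k ∈ Finset.range n, t k + ∑' k, t (k + n) := by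
    rw [hs.summable.sum_add_tsum_nat_add, hs.tsum_eq]
  have h1 : ‖∑ k ∈ Finset.range n, t k‖ ≤ D * x ^ (-(M : ℤ)) := by
    rw [Real.norm_of_nonneg (Finset.sum_nonneg fun _ _ => by positivity),
      Real.norm_of_nonneg (by positivity)] at hD
    refine (norm_sum_le _ _).trans (le_trans (Finset.sum_le_sum fun k _ => ?_) hD)
    rw [hnt]
    have hf1 : ((k.factorial : ℝ))⁻¹ ≤ 1 := inv_le_one_of_one_le₀ (by exact_mod_cast k.factorial_pos)
    calc (k.factorial : ℝ)⁻¹ * (‖w - x‖ ^ k * ‖iteratedDeriv k f (x : ℂ)‖)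
        ≤ 1 * (r ^ k * ‖iteratedDeriv k f (x : ℂ)‖) := by gcongr
      _ = _ := by ring
  have h2 : ‖∑' k, t (k + n)‖ ≤ C * (16 * r) ^ n * 2 * x ^ (-(M : ℤ)) := by
    refine (tsum_of_norm_bounded hgeo fun k => htail (k + n)).trans ?_
    have hinv : (1 - θ)⁻¹ ≤ 2 := by
      rw [inv_le_comm₀ (by linarith) (by norm_num)]; linarith
    calc C * x ^ K * (θ ^ n * (1 - θ)⁻¹) ≤ C * x ^ K * (θ ^ n * 2) := by gcongr
      _ = C * (16 * r) ^ n * 2 * x ^ (-(M : ℤ)) := by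
        have h3 : x ^ K * θ ^ n = (16 * r) ^ n * x ^ (-(M : ℤ)) := by
          rw [hθ, div_pow, zpow_neg, zpow_natCast, hn, pow_add x]
          field_simp
        calc C * x ^ K * (θ ^ n * 2) = C * (x ^ K * θ ^ n) * 2 := by ring
          _ = _ := by rw [h3]; ring
  rw [hsplit, add_mul]
  exact (norm_add_le _ _).trans (add_le_add h1 h2)

/-- Cauchy's estimate turns a uniform bound near the real axis into one for the derivative. -/
theorem eventually_norm_deriv_le {f : ℂ → ℂ} {D : ℝ} {φ : ℝ → ℝ} {r : ℝ}
    (hd : ∀ᶠ x : ℝ in atTop, DifferentiableOn ℂ f (Metric.ball (x : ℂ) (x / 8)))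
    (hD : ∀ᶠ x : ℝ in atTop, ∀ w : ℂ, ‖w - x‖ ≤ r + 1 → ‖f w‖ ≤ D * φ x) :
    ∀ᶠ x : ℝ in atTop, ∀ w : ℂ, ‖w - x‖ ≤ r → ‖deriv f w‖ ≤ D * φ x := by
  filter_upwards [hd, hD, eventually_gt_atTop (8 * (r + 1))] with x hd hD hx w hw
  have hsub : ∀ u ∈ Metric.closedBall w 1, ‖u - x‖ ≤ r + 1 := by
    intro u hu
    rw [mem_closedBall_iff_norm] at hu
    calc ‖u - x‖ ≤ ‖u - w‖ + ‖w - x‖ := norm_sub_le_norm_sub_add_norm_sub _ _ _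
      _ ≤ r + 1 := by linarith
  have hcl : DiffContOnCl ℂ f (Metric.ball w 1) :=
    hd.diffContOnCl_ball fun u hu => by
      rw [mem_ball_iff_norm]; have := hsub u hu; linarith
  simpa using Complex.norm_deriv_le_of_forall_mem_sphere_norm_le one_pos hcl
    fun z hz => hD z (hsub z (Metric.sphere_subset_closedBall hz))

/-! ### Asymptotic expansions at the origin -/

/-- Taylor expansion along the real axis. -/
theorem AnalyticAt.isBigO_taylor_ofReal {φ : ℂ → ℂ} {x : ℂ} (hφ : AnalyticAt ℂ φ x) (N : ℕ) :
    (fun t : ℝ => φ (x + t) - ∑ k ∈ Finset.range N,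
      iteratedDeriv k φ x / k.factorial * (t : ℂ) ^ k) =O[𝓝[>] 0] fun t : ℝ => t ^ N := by
  have h := hφ.hasFPowerSeriesAt.isBigO_sub_partialSum_pow N
  have ht : Tendsto (fun t : ℝ => (t : ℂ)) (𝓝[>] 0) (𝓝 0) :=
    tendsto_nhdsWithin_of_tendsto_nhds (by
      simpa using Complex.continuous_ofReal.tendsto 0)
  have h2 := (h.comp_tendsto ht).norm_right
  refine (h2.congr (fun t => ?_) fun t => ?_ : _ =O[_] fun t : ℝ => ‖t ^ N‖).of_norm_right
  · simp [FormalMultilinearSeries.partialSum, mul_comm]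
  · simp

/-- The coefficients of an asymptotic expansion in powers of `t` at `0⁺` are unique. -/
theorem eq_zero_of_sum_isBigO {e : ℕ → ℂ} {N : ℕ}
    (h : (fun t : ℝ => ∑ k ∈ Finset.range N, e k * (t : ℂ) ^ k)
      =O[𝓝[>] 0] fun t : ℝ => t ^ N) : ∀ k < N, e k = 0 := by
  induction N generalizing e with
  | zero => simp
  | succ N ih =>
    have hz : Tendsto (fun t : ℝ => t ^ (N + 1)) (𝓝[>] 0) (𝓝 0) :=
      tendsto_nhdsWithin_of_tendsto_nhds (by
        simpa using (continuous_pow (M := ℝ) (N + 1)).tendsto 0)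
    have h0 : Tendsto (fun t : ℝ => ∑ k ∈ Finset.range (N + 1), e k * (t : ℂ) ^ k)
        (𝓝[>] 0) (𝓝 (e 0)) := by
      have hc : Continuous fun t : ℝ => ∑ k ∈ Finset.range (N + 1), e k * (t : ℂ) ^ k := by
        fun_prop
      have := hc.tendsto 0
      simp only [Finset.sum_range_succ', Complex.ofReal_zero, ne_eq, Nat.add_eq_zero_iff,
        one_ne_zero, and_false, not_false_eq_true, zero_pow, mul_zero, Finset.sum_const_zero,
        pow_zero, mul_one, zero_add] at this
      simpa only [Finset.sum_range_succ', pow_zero, mul_one] using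
        tendsto_nhdsWithin_of_tendsto_nhds this
    have he0 : e 0 = 0 := tendsto_nhds_unique h0 (h.trans_tendsto hz)
    have h1 : (fun t : ℝ => ∑ k ∈ Finset.range N, e (k + 1) * (t : ℂ) ^ k)
        =O[𝓝[>] 0] fun t : ℝ => t ^ N := by
      have hinv : (fun t : ℝ => (t : ℂ)⁻¹) =O[𝓝[>] 0] fun t : ℝ => t⁻¹ :=
        IsBigO.of_norm_norm (IsBigO.of_bound' (Eventually.of_forall fun t => by simp))
      refine (hinv.mul h).congr' ?_ ?_
      · filter_upwards [self_mem_nhdsWithin] with t ht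
        have ht' : (t : ℂ) ≠ 0 := by exact_mod_cast (ne_of_gt ht)
        rw [Finset.sum_range_succ', he0, zero_mul, add_zero, Finset.mul_sum]
        refine Finset.sum_congr rfl fun k _ => ?_
        field_simp
        ring
      · filter_upwards [self_mem_nhdsWithin] with t ht
        have ht' : t ≠ 0 := ne_of_gt ht
        rw [pow_succ']
        field_simp
    intro k hk
    rcases k with _ | k
    · exact he0
    · exact ih h1 k (by omega)

theorem isBigO_pow_succ_pow (N : ℕ) :
    (fun t : ℝ => t ^ (N + 1)) =O[𝓝[>] 0] fun t : ℝ => t ^ N :=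
  IsBigO.of_bound' (by
    filter_upwards [Ioo_mem_nhdsGT (zero_lt_one (α := ℝ))] with t ht
    have h0 : 0 < t := ht.1
    rw [Real.norm_of_nonneg (by positivity), Real.norm_of_nonneg (by positivity)]
    exact pow_le_pow_of_le_one h0.le ht.2.le (Nat.le_succ N))

/-- A function approximated to every order at `0⁺` by analytic functions has an asymptotic
expansion in powers of `t`. -/
theorem exists_asymptotic_expansion {f : ℝ → ℂ}
    (h : ∀ N : ℕ, ∃ φ : ℂ → ℂ, AnalyticAt ℂ φ 0 ∧
      (fun t : ℝ => f t - φ t) =O[𝓝[>] 0] fun t : ℝ => t ^ N) :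
    ∃ c : ℕ → ℂ, ∀ N : ℕ, (fun t : ℝ => f t - ∑ k ∈ Finset.range N, c k * (t : ℂ) ^ k)
      =O[𝓝[>] 0] fun t : ℝ => t ^ N := by
  have h1 : ∀ N : ℕ, ∃ d : ℕ → ℂ, (fun t : ℝ => f t - ∑ k ∈ Finset.range N, d k * (t : ℂ) ^ k)
      =O[𝓝[>] 0] fun t : ℝ => t ^ N := by
    intro N
    obtain ⟨φ, hφ, hO⟩ := h N
    refine ⟨fun k => iteratedDeriv k φ 0 / k.factorial, ?_⟩
    refine (hO.add (hφ.isBigO_taylor_ofReal N)).congr_left fun t => ?_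
    simp
  choose d hd using h1
  refine ⟨fun k => d (k + 1) k, fun N => ?_⟩
  induction N with
  | zero => simpa using hd 0
  | succ N ih =>
    have hlow : (fun t : ℝ => f t - ∑ k ∈ Finset.range N, d (N + 1) k * (t : ℂ) ^ k)
        =O[𝓝[>] 0] fun t : ℝ => t ^ N := by
      have h2 : (fun t : ℝ => d (N + 1) N * (t : ℂ) ^ N) =O[𝓝[>] 0] fun t : ℝ => t ^ N :=
        IsBigO.of_bound ‖d (N + 1) N‖ (Eventually.of_forall fun t => by simp)
      refine (((hd (N + 1)).trans (isBigO_pow_succ_pow N)).add h2).congr_left fun t => ?_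
      rw [Finset.sum_range_succ]; ring
    have hdiff := eq_zero_of_sum_isBigO
      (e := fun k => d (N + 1) k - d (k + 1) k) (N := N)
      ((ih.sub hlow).congr_left fun t => by
        simp only [sub_mul, Finset.sum_sub_distrib]; ring)
    refine (hd (N + 1)).congr_left fun t => ?_
    rw [Finset.sum_range_succ, Finset.sum_range_succ]
    congr 2
    exact Finset.sum_congr rfl fun k hk => by
      rw [sub_eq_zero.1 (hdiff k (Finset.mem_range.1 hk))]

/-! ### Meromorphic continuation of Mellin transforms -/

/-- The truncation to `(0, 1]` of the first `N` terms of an expansion in powers of `t`. -/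
noncomputable def truncatedExpansion (c : ℕ → ℂ) (N : ℕ) : ℝ → ℂ :=
  Set.indicator (Set.Ioc 0 1) fun t => ∑ k ∈ Finset.range N, c k * (t : ℂ) ^ k

/-- The continuation of the Mellin transform of `f` to `-N < Re s`: the first `N` terms of the
expansion of `f` at `0` are split off on `(0, 1]` and integrated explicitly. -/
noncomputable def mellinCont (f : ℝ → ℂ) (c : ℕ → ℂ) (N : ℕ) (s : ℂ) : ℂ :=
  mellin (fun t => f t - truncatedExpansion c N t) s + ∑ k ∈ Finset.range N, c k / (s + k)

section MellinCont

variable {f : ℝ → ℂ} {c : ℕ → ℂ}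

theorem locallyIntegrableOn_sub_truncatedExpansion
    (hf : MeasureTheory.LocallyIntegrableOn f (Set.Ioi 0)) (N : ℕ) :
    MeasureTheory.LocallyIntegrableOn (fun t => f t - truncatedExpansion c N t) (Set.Ioi 0) := by
  refine hf.sub (MeasureTheory.LocallyIntegrable.locallyIntegrableOn
    (MeasureTheory.Integrable.locallyIntegrable ?_) _)
  refine (MeasureTheory.integrable_indicator_iff measurableSet_Ioc).2 ?_
  exact Continuous.integrableOn_Ioc (by fun_prop)

theorem sub_truncatedExpansion_isBigO_atTop {a : ℝ} (ha : f =O[atTop] fun t : ℝ => t ^ (-a))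
    (N : ℕ) :
    (fun t => f t - truncatedExpansion c N t) =O[atTop] fun t : ℝ => t ^ (-a) := by
  refine ha.congr' ?_ EventuallyEq.rfl
  filter_upwards [eventually_gt_atTop 1] with t ht
  rw [truncatedExpansion, Set.indicator_of_notMem (by simp [ht]), sub_zero]

theorem sub_truncatedExpansion_isBigO_zero
    (hc : ∀ N : ℕ, (fun t : ℝ => f t - ∑ k ∈ Finset.range N, c k * (t : ℂ) ^ k)
      =O[𝓝[>] 0] fun t : ℝ => t ^ N) (N : ℕ) :
    (fun t => f t - truncatedExpansion c N t) =O[𝓝[>] 0] fun t : ℝ => t ^ (-(-(N : ℝ))) := by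
  refine (hc N).congr' ?_ ?_
  · filter_upwards [Ioc_mem_nhdsGT (zero_lt_one (α := ℝ))] with t ht
    rw [truncatedExpansion, Set.indicator_of_mem ht]
  · exact Eventually.of_forall fun t => by simp

variable {a : ℝ} (hf : MeasureTheory.LocallyIntegrableOn f (Set.Ioi 0))
  (hc : ∀ N : ℕ, (fun t : ℝ => f t - ∑ k ∈ Finset.range N, c k * (t : ℂ) ^ k)
      =O[𝓝[>] 0] fun t : ℝ => t ^ N)
  (ha : f =O[atTop] fun t : ℝ => t ^ (-a))

include hf hc

include ha in
theorem mellinCont_succ {N : ℕ} {s : ℂ} (hs : -(N : ℝ) < s.re) (hsa : s.re < a) :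
    mellinCont f c (N + 1) s = mellinCont f c N s := by
  have h1 : MellinConvergent (fun t => f t - truncatedExpansion c N t) s :=
    mellinConvergent_of_isBigO_rpow (locallyIntegrableOn_sub_truncatedExpansion hf N)
      (sub_truncatedExpansion_isBigO_atTop ha N) hsa
      (sub_truncatedExpansion_isBigO_zero hc N) hs
  have h2 := hasMellin_cpow_Ioc (N : ℂ) (s := s) (by simp; linarith)
  have h3 := hasMellin_const_smul h2.1 (c N)
  have h4 := (hasMellin_sub h1 h3.1).2
  have h5 : (fun t => f t - truncatedExpansion c (N + 1) t) = fun t =>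
      (f t - truncatedExpansion c N t) -
        c N • Set.indicator (Set.Ioc 0 1) (fun t : ℝ => (t : ℂ) ^ (N : ℂ)) t := by
    funext t
    by_cases ht : t ∈ Set.Ioc (0 : ℝ) 1
    · simp [truncatedExpansion, Set.indicator_of_mem ht, Finset.sum_range_succ]; ring
    · simp [truncatedExpansion, Set.indicator_of_notMem ht]
  rw [mellinCont, mellinCont, h5, h4, h3.2, h2.2, Finset.sum_range_succ]
  simp only [smul_eq_mul]
  ring

include ha in
theorem mellinCont_eq {N M : ℕ} {s : ℂ} (hs : -(N : ℝ) < s.re) (hM : -(M : ℝ) < s.re)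
    (hsa : s.re < a) : mellinCont f c N s = mellinCont f c M s := by
  wlog hNM : N ≤ M generalizing N M
  · exact (this hM hs (le_of_not_ge hNM)).symm
  induction M, hNM using Nat.le_induction with
  | base => rfl
  | succ M hNM ih =>
    have hM' : -(M : ℝ) < s.re :=
      lt_of_le_of_lt (neg_le_neg (by exact_mod_cast hNM)) hs
    rw [mellinCont_succ hf hc ha hM' hsa, ih hM']

include ha in
theorem analyticAt_mellin_sub_truncatedExpansion {N : ℕ} {s : ℂ} (hs : -(N : ℝ) < s.re)
    (hsa : s.re < a) :
    AnalyticAt ℂ (mellin fun t => f t - truncatedExpansion c N t) s := by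
  have ho : IsOpen {z : ℂ | -(N : ℝ) < z.re ∧ z.re < a} :=
    (isOpen_lt continuous_const Complex.continuous_re).inter
      (isOpen_lt Complex.continuous_re continuous_const)
  refine DifferentiableOn.analyticAt (s := {z : ℂ | -(N : ℝ) < z.re ∧ z.re < a}) ?_
    (ho.mem_nhds ⟨hs, hsa⟩)
  intro z hz
  exact (mellin_differentiableAt_of_isBigO_rpow (locallyIntegrableOn_sub_truncatedExpansion hf N)
      (sub_truncatedExpansion_isBigO_atTop ha N) hz.2
      (sub_truncatedExpansion_isBigO_zero hc N) hz.1).differentiableWithinAt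

/-- The Mellin transform of a function with an expansion `∑ c k * t ^ k` at `0⁺` continues
meromorphically to the left, with at most simple poles at `s = -k` of residue `c k`. The
continuation does not depend on the decay rate `a` at infinity, which only limits where it is
defined. -/
theorem exists_mellin_continuation :
    ∃ F : ℂ → ℂ, ∀ a : ℝ, (f =O[atTop] fun t : ℝ => t ^ (-a)) →
      (∀ s : ℂ, 0 < s.re → s.re < a → F s = mellin f s) ∧
      (∀ s : ℂ, s.re < a → (∀ k : ℕ, s ≠ -(k : ℂ)) → AnalyticAt ℂ F s) ∧
      ∀ k : ℕ, -(k : ℝ) < a → HasSimplePolarPart F (-(k : ℂ)) (c k) := by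
  refine ⟨fun s => mellinCont f c (⌊-s.re⌋₊ + 1) s, fun a ha => ?_⟩
  have hfl : ∀ s : ℂ, -((⌊-s.re⌋₊ + 1 : ℕ) : ℝ) < s.re := fun s => by
    have := Nat.lt_floor_add_one (-s.re)
    push_cast
    linarith
  have heq : ∀ (N : ℕ) (s : ℂ), -(N : ℝ) < s.re → s.re < a →
      mellinCont f c (⌊-s.re⌋₊ + 1) s = mellinCont f c N s :=
    fun N s hs hsa => mellinCont_eq hf hc ha (hfl s) hs hsa
  have hev : ∀ (N : ℕ) (s : ℂ), -(N : ℝ) < s.re → s.re < a →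
      (fun s => mellinCont f c (⌊-s.re⌋₊ + 1) s) =ᶠ[𝓝 s] mellinCont f c N := by
    intro N s hs hsa
    filter_upwards [(isOpen_lt continuous_const Complex.continuous_re).mem_nhds hs,
      (isOpen_lt Complex.continuous_re continuous_const).mem_nhds hsa] with z hz hza
    exact heq N z hz hza
  refine ⟨fun s hs hsa => ?_, fun s hsa hs => ?_, fun k hk => ?_⟩
  · show mellinCont f c (⌊-s.re⌋₊ + 1) s = _
    rw [heq 0 s (by simpa using hs) hsa]
    simp [mellinCont, truncatedExpansion]
  · rw [analyticAt_congr (hev _ s (hfl s) hsa)]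
    refine (analyticAt_mellin_sub_truncatedExpansion hf hc ha (hfl s) hsa).add
      (Finset.analyticAt_fun_sum _ fun k _ => ?_)
    refine analyticAt_const.div (by fun_prop) fun h => hs k ?_
    exact eq_neg_of_add_eq_zero_left h
  · have hre : -((k + 1 : ℕ) : ℝ) < (-(k : ℂ)).re := by simp
    have hka : (-(k : ℂ)).re < a := by simpa using hk
    refine ⟨fun s => mellin (fun t => f t - truncatedExpansion c (k + 1) t) s +
      ∑ j ∈ Finset.range k, c j / (s + j), ?_, ?_⟩
    · refine (analyticAt_mellin_sub_truncatedExpansion hf hc ha hre hka).add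
        (Finset.analyticAt_fun_sum _ fun j hj => ?_)
      refine analyticAt_const.div (by fun_prop) fun h => ?_
      have h1 : (j : ℂ) = k := by linear_combination h
      exact (Finset.mem_range.1 hj).ne (by exact_mod_cast h1)
    · filter_upwards [(hev (k + 1) _ hre hka).filter_mono nhdsWithin_le_nhds] with s hs
      rw [hs, mellinCont, Finset.sum_range_succ, sub_neg_eq_add]
      ring

end MellinCont

/-! ### The Mellin transform of `(w + y)⁻²` -/

/-- If the angle between `w` and the negative real axis is bounded below, then `‖w + y‖` and
`‖w‖ + y` are comparable. -/
theorem sqrt_mul_le_norm_add {w : ℂ} {κ y : ℝ} (hκ : κ ≤ 1) (hκ0 : 0 ≤ κ) (hw : -w.re ≤ κ * ‖w‖)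
    (hy : 0 ≤ y) : √((1 - κ) / 2) * (‖w‖ + y) ≤ ‖w + y‖ := by
  refine abs_le_of_sq_le_sq' ?_ (norm_nonneg _) |>.2
  rw [mul_pow, Real.sq_sqrt (by linarith)]
  have h1 : ‖w + y‖ ^ 2 = ‖w‖ ^ 2 + 2 * w.re * y + y ^ 2 := by
    rw [Complex.sq_norm, Complex.sq_norm, Complex.normSq_apply, Complex.normSq_apply]
    simp
    ring
  have h2 : 2 * (-w.re) * y ≤ 2 * (κ * ‖w‖) * y := by gcongr
  rw [h1]
  nlinarith [sq_nonneg (‖w‖ - y), norm_nonneg w, mul_nonneg hκ0 (sq_nonneg (‖w‖ - y)),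
    mul_nonneg (sub_nonneg.2 hκ) (sq_nonneg (‖w‖ - y))]

theorem Complex.neg_re_lt_norm_of_mem_slitPlane {w : ℂ} (hw : w ∈ Complex.slitPlane) :
    -w.re < ‖w‖ := by
  rcases lt_or_ge (-w.re) ‖w‖ with h | h
  · exact h
  · exfalso
    have h1 : |w.re| ≤ ‖w‖ := Complex.abs_re_le_norm w
    have h2 : ‖w‖ = -w.re := le_antisymm h ((neg_le_abs _).trans h1)
    have h3 : w.re ≤ 0 := by have := norm_nonneg w; linarith
    have h4 : |w.re| = ‖w‖ := by rw [abs_of_nonpos h3, h2]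
    have h5 : w.im = 0 := Complex.abs_re_eq_norm.1 h4
    rcases hw with hw | hw
    · linarith
    · exact hw h5

theorem exists_pos_mul_le_norm_add {w : ℂ} (hw : w ∈ Complex.slitPlane) :
    ∃ c : ℝ, 0 < c ∧ ∀ y : ℝ, 0 ≤ y → c * (‖w‖ + y) ≤ ‖w + y‖ := by
  have hw0 : 0 < ‖w‖ := norm_pos_iff.2 (Complex.slitPlane_ne_zero hw)
  have h := Complex.neg_re_lt_norm_of_mem_slitPlane hw
  have hlt : max 0 (-w.re / ‖w‖) < 1 := max_lt one_pos ((div_lt_one hw0).2 h)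
  refine ⟨√((1 - max 0 (-w.re / ‖w‖)) / 2), Real.sqrt_pos.2 (by linarith), fun y hy => ?_⟩
  refine sqrt_mul_le_norm_add hlt.le (le_max_left _ _) ?_ hy
  calc -w.re = -w.re / ‖w‖ * ‖w‖ := by field_simp
    _ ≤ _ := by gcongr; exact le_max_right _ _

/-- The substitution `y = u / (1 - u)` in Euler's beta integral. -/
theorem mellin_inv_one_add_sq {z : ℂ} (hz : 0 < z.re) (hz2 : z.re < 2) :
    mellin (fun y : ℝ => (((1 : ℂ) + y) ^ 2)⁻¹) z = Complex.Gamma z * Complex.Gamma (2 - z) := by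
  rw [Complex.Gamma_mul_Gamma_eq_betaIntegral hz (by simpa using hz2)]
  have himg : (fun u : ℝ => u / (1 - u)) '' Set.Ioo 0 1 = Set.Ioi 0 := by
    ext y
    constructor
    · rintro ⟨u, hu, rfl⟩
      exact div_pos hu.1 (by linarith [hu.2])
    · intro hy
      have hy' : (0 : ℝ) < y := hy
      refine ⟨y / (1 + y), ⟨by positivity, (div_lt_one (by positivity)).2 (by linarith)⟩, ?_⟩
      field_simp
      ring
  have hd : ∀ u ∈ Set.Ioo (0 : ℝ) 1,
      HasDerivWithinAt (fun u : ℝ => u / (1 - u)) (1 / (1 - u) ^ 2) (Set.Ioo 0 1) u := by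
    intro u hu
    have h1 : 1 - u ≠ 0 := by linarith [hu.2]
    have := (hasDerivAt_id u).div ((hasDerivAt_id u).const_sub 1) h1
    exact (this.congr_deriv (by simp)).hasDerivWithinAt
  have hinj : Set.InjOn (fun u : ℝ => u / (1 - u)) (Set.Ioo 0 1) := by
    intro u hu v hv h
    have h1 : 1 - u ≠ 0 := by linarith [hu.2]
    have h2 : 1 - v ≠ 0 := by linarith [hv.2]
    change u / (1 - u) = v / (1 - v) at h
    rw [div_eq_div_iff h1 h2] at h
    linarith
  rw [mellin, ← himg, MeasureTheory.integral_image_eq_integral_abs_deriv_smul measurableSet_Ioo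
    hd hinj, Complex.betaIntegral, intervalIntegral.integral_of_le zero_le_one,
    MeasureTheory.integral_Ioc_eq_integral_Ioo]
  have hG : Complex.Gamma (z + (2 - z)) = 1 := by
    rw [add_sub_cancel]
    simp
  rw [hG, one_mul]
  refine MeasureTheory.setIntegral_congr_fun measurableSet_Ioo fun u hu => ?_
  have hu0 : 0 < u := hu.1
  have h1 : 0 < 1 - u := by linarith [hu.2]
  have h1c : (1 - u : ℂ) ≠ 0 := by
    have : ((1 - u : ℝ) : ℂ) ≠ 0 := by exact_mod_cast h1.ne'
    simpa using this
  have h2 : ((u / (1 - u) : ℝ) : ℂ) ^ (z - 1) = (u : ℂ) ^ (z - 1) * (1 - u : ℂ) ^ (1 - z) := by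
    rw [div_eq_mul_inv, Complex.ofReal_mul,
      Complex.mul_cpow_ofReal_nonneg hu0.le (inv_pos.2 h1).le, Complex.ofReal_inv,
      Complex.inv_cpow _ _ (by
        rw [Complex.arg_ofReal_of_nonneg h1.le]; exact Real.pi_pos.ne), ← Complex.cpow_neg,
        neg_sub]
    simp
  have h3 : (1 + ((u / (1 - u) : ℝ) : ℂ)) = (1 - u : ℂ)⁻¹ := by
    push_cast
    field_simp
    ring
  rw [h2, h3, abs_of_pos (by positivity), Complex.real_smul, smul_eq_mul]
  have h4 : (2 - z - 1 : ℂ) = 1 - z := by ring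
  rw [h4]
  push_cast
  field_simp

theorem mellin_inv_add_sq_ofReal {r : ℝ} (hr : 0 < r) {z : ℂ} (hz : 0 < z.re) (hz2 : z.re < 2) :
    mellin (fun y : ℝ => (((r : ℂ) + y) ^ 2)⁻¹) z
      = (r : ℂ) ^ (z - 2) * (Complex.Gamma z * Complex.Gamma (2 - z)) := by
  have hr0 : (r : ℂ) ≠ 0 := by exact_mod_cast hr.ne'
  set k : ℝ → ℂ := fun t : ℝ => (((1 : ℂ) + t) ^ 2)⁻¹ with hk
  have h1 : (fun y : ℝ => (((r : ℂ) + y) ^ 2)⁻¹) = fun y : ℝ => ((r : ℂ) ^ 2)⁻¹ •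
      k (r⁻¹ * y) := by
    funext y
    have : (1 + ((r⁻¹ * y : ℝ) : ℂ)) = (r + y) / r := by
      push_cast
      field_simp
    simp only [hk, this, div_pow, smul_eq_mul]
    field_simp
  rw [h1, mellin_const_smul, mellin_comp_mul_left k _ (inv_pos.2 hr), hk, mellin_inv_one_add_sq hz hz2,
    Complex.ofReal_inv, Complex.inv_cpow _ _ (by
      rw [Complex.arg_ofReal_of_nonneg hr.le]; exact Real.pi_pos.ne), ← Complex.cpow_neg,
    Complex.cpow_sub _ _ hr0]
  simp only [smul_eq_mul, neg_neg, Complex.cpow_ofNat]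
  field_simp

theorem locallyIntegrableOn_inv_add_sq {w : ℂ} (hw : w ∈ Complex.slitPlane) :
    MeasureTheory.LocallyIntegrableOn (fun y : ℝ => ((w + y) ^ 2)⁻¹) (Set.Ioi 0) := by
  obtain ⟨c, hc, hcw⟩ := exists_pos_mul_le_norm_add hw
  refine ContinuousOn.locallyIntegrableOn ?_ measurableSet_Ioi
  refine ContinuousOn.inv₀ (by fun_prop) fun y hy => pow_ne_zero 2 (norm_pos_iff.1 ?_)
  have hy' : (0 : ℝ) < y := hy
  exact lt_of_lt_of_le (by positivity) (hcw y hy'.le)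

/-- For real `r > 0`, the function `y ^ (σ - 1) (r + y) ^ (-2)` is integrable on `(0, ∞)`. -/
theorem integrableOn_rpow_div_add_sq {r σ : ℝ} (hr : 0 < r) (hσ : 0 < σ) (hσ2 : σ < 2) :
    MeasureTheory.IntegrableOn (fun y : ℝ => y ^ (σ - 1) * ((r + y) ^ 2)⁻¹) (Set.Ioi 0) := by
  have hloc : MeasureTheory.LocallyIntegrableOn (fun y : ℝ => ((r + y) ^ 2)⁻¹) (Set.Ioi 0) := by
    refine ContinuousOn.locallyIntegrableOn ?_ measurableSet_Ioi
    refine ContinuousOn.inv₀ (by fun_prop) fun y hy => ?_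
    have hy' : (0 : ℝ) < y := hy
    positivity
  refine mellin_convergent_of_isBigO_scalar (a := 2) (b := 0) hloc ?_ hσ2 ?_ hσ
  · refine IsBigO.of_bound 1 ?_
    filter_upwards [eventually_gt_atTop 0] with y hy
    rw [Real.norm_of_nonneg (by positivity), Real.norm_of_nonneg (by positivity), one_mul,
      Real.rpow_neg hy.le, Real.rpow_two]
    gcongr
    linarith
  · refine IsBigO.of_bound ((r ^ 2)⁻¹) ?_
    filter_upwards [self_mem_nhdsWithin] with y hy
    have hy' : (0 : ℝ) < y := hy
    rw [Real.norm_of_nonneg (by positivity)]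
    simp only [neg_zero, Real.rpow_zero, norm_one, mul_one]
    gcongr
    linarith

theorem norm_cpow_smul_inv_add_sq_le {w : ℂ} {c : ℝ} (hc : 0 < c) (hw0 : w ≠ 0) {y : ℝ}
    (hy : 0 < y) (hcw : c * (‖w‖ + y) ≤ ‖w + y‖) (z : ℂ) :
    ‖(y : ℂ) ^ (z - 1) • ((w + y) ^ 2)⁻¹‖
      ≤ (c ^ 2)⁻¹ * (y ^ (z.re - 1) * ((‖w‖ + y) ^ 2)⁻¹) := by
  have hw : 0 < ‖w‖ := norm_pos_iff.2 hw0
  rw [norm_smul, Complex.norm_cpow_eq_rpow_re_of_pos hy, norm_inv, norm_pow]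
  calc y ^ (z - 1).re * (‖w + y‖ ^ 2)⁻¹ ≤ y ^ (z - 1).re * ((c * (‖w‖ + y)) ^ 2)⁻¹ := by gcongr
    _ = _ := by rw [mul_pow, mul_inv]; simp; ring

theorem mellinConvergent_inv_add_sq {w : ℂ} (hw : w ∈ Complex.slitPlane) {z : ℂ} (hz : 0 < z.re)
    (hz2 : z.re < 2) : MellinConvergent (fun y : ℝ => ((w + y) ^ 2)⁻¹) z := by
  obtain ⟨c, hc, hcw⟩ := exists_pos_mul_le_norm_add hw
  have hw0 := Complex.slitPlane_ne_zero hw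
  refine MeasureTheory.Integrable.mono'
    ((integrableOn_rpow_div_add_sq (norm_pos_iff.2 hw0) hz hz2).const_mul (c ^ 2)⁻¹) ?_ ?_
  · refine MeasureTheory.AEStronglyMeasurable.mul ?_
      (locallyIntegrableOn_inv_add_sq hw).aestronglyMeasurable
    refine ContinuousOn.aestronglyMeasurable ?_ measurableSet_Ioi
    exact continuousOn_of_forall_continuousAt fun t ht =>
      Complex.continuousAt_ofReal_cpow_const _ _ (Or.inr <| ne_of_gt ht)
  · filter_upwards [MeasureTheory.self_mem_ae_restrict measurableSet_Ioi] with y hy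
    exact norm_cpow_smul_inv_add_sq_le hc hw0 hy (hcw y (le_of_lt hy)) z

/-- Holomorphy in `w` of the Mellin transform of `(w + y)⁻²`. -/
theorem differentiableOn_mellin_inv_add_sq {z : ℂ} (hz : 0 < z.re) (hz2 : z.re < 2) :
    DifferentiableOn ℂ (fun w : ℂ => mellin (fun y : ℝ => ((w + y) ^ 2)⁻¹) z)
      Complex.slitPlane := by
  intro w hw
  obtain ⟨c, hc, hcw⟩ := exists_pos_mul_le_norm_add hw
  have hw0 : 0 < ‖w‖ := norm_pos_iff.2 (Complex.slitPlane_ne_zero hw)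
  have hball : Metric.ball w (c * ‖w‖ / 2) ∩ Complex.slitPlane ∈ 𝓝 w :=
    inter_mem (Metric.ball_mem_nhds _ (by positivity)) (Complex.isOpen_slitPlane.mem_nhds hw)
  have hlow : ∀ v ∈ Metric.ball w (c * ‖w‖ / 2), ∀ y : ℝ, 0 < y →
      c / 2 * (‖w‖ + y) ≤ ‖v + y‖ := by
    intro v hv y hy
    rw [mem_ball_iff_norm, norm_sub_rev] at hv
    have h1 := hcw y hy.le
    have h2 : ‖w + y‖ ≤ ‖w - v‖ + ‖v + y‖ := by
      have := norm_add_le (w - v) (v + y)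
      rwa [show w - v + (v + y) = w + y by ring] at this
    nlinarith
  have hmeas : ∀ v ∈ Complex.slitPlane, MeasureTheory.AEStronglyMeasurable
      (fun y : ℝ => (y : ℂ) ^ (z - 1) • ((v + y) ^ 2)⁻¹)
      (MeasureTheory.volume.restrict (Set.Ioi 0)) :=
    fun v hv => (mellinConvergent_inv_add_sq hv hz hz2).aestronglyMeasurable
  have key := hasDerivAt_integral_of_dominated_loc_of_deriv_le
    (F := fun (v : ℂ) (y : ℝ) => (y : ℂ) ^ (z - 1) • ((v + y) ^ 2)⁻¹)
    (F' := fun (v : ℂ) (y : ℝ) => (y : ℂ) ^ (z - 1) * (-2 * ((v + y) ^ 3)⁻¹))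
    (bound := fun y : ℝ => 2 * ((c / 2) ^ 3)⁻¹ * (‖w‖)⁻¹ *
      (y ^ (z.re - 1) * ((‖w‖ + y) ^ 2)⁻¹))
    (μ := MeasureTheory.volume.restrict (Set.Ioi 0)) hball
    (by filter_upwards [Complex.isOpen_slitPlane.mem_nhds hw] with v hv using hmeas v hv)
    (mellinConvergent_inv_add_sq hw hz hz2) ?_ ?_
    ((integrableOn_rpow_div_add_sq hw0 hz hz2).const_mul _) ?_
  · exact key.2.differentiableAt.differentiableWithinAt
  · refine ContinuousOn.aestronglyMeasurable (fun y hy => ?_) measurableSet_Ioi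
    have hy' : (0 : ℝ) < y := hy
    refine ContinuousAt.continuousWithinAt ?_
    refine (Complex.continuousAt_ofReal_cpow_const _ _ (Or.inr hy'.ne')).mul
      (continuousAt_const.mul (ContinuousAt.inv₀ (by fun_prop) (pow_ne_zero 3 ?_)))
    exact norm_pos_iff.1 (lt_of_lt_of_le (by positivity) (hcw y hy'.le))
  · filter_upwards [MeasureTheory.self_mem_ae_restrict measurableSet_Ioi] with y hy v hv
    have hy' : (0 : ℝ) < y := hy
    have h1 := hlow v hv.1 y hy'
    rw [norm_mul, Complex.norm_cpow_eq_rpow_re_of_pos hy', norm_mul, norm_inv, norm_pow, norm_neg,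
      Complex.norm_ofNat]
    calc y ^ (z - 1).re * (2 * (‖v + y‖ ^ 3)⁻¹)
        ≤ y ^ (z - 1).re * (2 * ((c / 2 * (‖w‖ + y)) ^ 3)⁻¹) := by gcongr
      _ = 2 * ((c / 2) ^ 3)⁻¹ * (‖w‖ + y)⁻¹ * (y ^ (z.re - 1) * ((‖w‖ + y) ^ 2)⁻¹) := by
          rw [mul_pow, mul_inv, Complex.sub_re, Complex.one_re, pow_succ (‖w‖ + y) 2, mul_inv]
          ring
      _ ≤ _ := by
          gcongr
          linarith
  · filter_upwards [MeasureTheory.self_mem_ae_restrict measurableSet_Ioi] with y hy v hv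
    have hy' : (0 : ℝ) < y := hy
    have hne : v + y ≠ 0 :=
      norm_pos_iff.1 (lt_of_lt_of_le (by positivity) (hlow v hv.1 y hy'))
    have h1 := (((hasDerivAt_id v).add_const (y : ℂ)).pow 2).inv (pow_ne_zero 2 hne)
    have h2 := h1.const_mul ((y : ℂ) ^ (z - 1))
    refine HasDerivAt.congr_deriv h2 ?_
    simp
    field_simp

/-- `∫₀^∞ y ^ (z - 1) (w + y)⁻² dy = w ^ (z - 2) Γ(z) Γ(2 - z)` for `w` in the slit plane. -/
theorem mellin_inv_add_sq {w : ℂ} (hw : w ∈ Complex.slitPlane) {z : ℂ} (hz : 0 < z.re)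
    (hz2 : z.re < 2) :
    mellin (fun y : ℝ => ((w + y) ^ 2)⁻¹) z
      = w ^ (z - 2) * (Complex.Gamma z * Complex.Gamma (2 - z)) := by
  have h1 : AnalyticOnNhd ℂ (fun w : ℂ => mellin (fun y : ℝ => ((w + y) ^ 2)⁻¹) z)
      Complex.slitPlane :=
    (differentiableOn_mellin_inv_add_sq hz hz2).analyticOnNhd Complex.isOpen_slitPlane
  have h2 : AnalyticOnNhd ℂ
      (fun w : ℂ => w ^ (z - 2) * (Complex.Gamma z * Complex.Gamma (2 - z)))
      Complex.slitPlane := fun v hv =>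
    (analyticAt_id.cpow analyticAt_const hv).mul analyticAt_const
  have hpre : IsPreconnected Complex.slitPlane :=
    (Complex.starConvex_one_slitPlane.isPathConnected
      Complex.one_mem_slitPlane).isConnected.isPreconnected
  refine h1.eqOn_of_preconnected_of_frequently_eq h2 hpre Complex.one_mem_slitPlane ?_ hw
  -- the two sides agree at the real points `1 + t`, `t > 0`, which accumulate at `1`
  have ht : Tendsto (fun t : ℝ => ((1 + t : ℝ) : ℂ)) (𝓝[>] 0) (𝓝[≠] 1) := by
    refine tendsto_nhdsWithin_iff.2 ⟨tendsto_nhdsWithin_of_tendsto_nhds ?_, ?_⟩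
    · have : Continuous fun t : ℝ => ((1 + t : ℝ) : ℂ) := by fun_prop
      simpa using this.tendsto 0
    · filter_upwards [self_mem_nhdsWithin] with t ht
      have : (t : ℂ) ≠ 0 := by exact_mod_cast (ne_of_gt ht)
      simpa using this
  refine ht.frequently (Eventually.frequently ?_)
  filter_upwards [self_mem_nhdsWithin] with t ht
  have ht' : (0 : ℝ) < t := ht
  exact mellin_inv_add_sq_ofReal (by linarith) hz hz2

/-! ### Zeros of entire functions of order one -/

/-- A function of order `1` is bounded by `K exp (‖z‖ ^ a)` on the whole plane, for `a > 1`. -/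
theorem IsEntireOfOrder.exists_norm_le {f : ℂ → ℂ} (hf : IsEntireOfOrder f 1) {a : ℝ}
    (ha : 1 < a) : ∃ K : ℝ, 0 < K ∧ ∀ z : ℂ, ‖f z‖ ≤ K * Real.exp (‖z‖ ^ a) := by
  obtain ⟨K, hK0, hK⟩ := (hf.2.1 a ha).exists_pos
  rw [IsBigOWith, ← comap_norm_atTop, eventually_comap] at hK
  obtain ⟨R, hR⟩ := eventually_atTop.1 hK
  obtain ⟨B, hB⟩ := (isCompact_closedBall (0 : ℂ) R).exists_bound_of_continuousOn
    hf.1.continuous.continuousOn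
  refine ⟨K + max B 0, by positivity, fun z => ?_⟩
  have h1 : 1 ≤ Real.exp (‖z‖ ^ a) := Real.one_le_exp (by positivity)
  rcases le_total R ‖z‖ with h | h
  · have := hR _ h z rfl
    rw [Real.norm_of_nonneg (Real.exp_pos _).le] at this
    refine this.trans ?_
    gcongr
    exact le_add_of_nonneg_right (le_max_right _ _)
  · calc ‖f z‖ ≤ B := hB z (by simpa using h)
      _ ≤ (K + max B 0) * 1 := by linarith [le_max_left B 0]
      _ ≤ _ := by gcongr

theorem analyticOrderAt_ne_top_of_differentiable {f : ℂ → ℂ} (hf : Differentiable ℂ f)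
    (h0 : f 0 ≠ 0) (z : ℂ) : analyticOrderAt f z ≠ ⊤ := by
  intro h
  have han : AnalyticOnNhd ℂ f Set.univ := fun z _ => hf.analyticAt z
  exact h0 (han.eqOn_zero_of_preconnected_of_eventuallyEq_zero isPreconnected_univ
    (Set.mem_univ z) (analyticOrderAt_eq_top.1 h) (Set.mem_univ 0))

/-- Division of an entire function by the power of `z - ρ` given by its order at `ρ`. -/
theorem exists_differentiable_eq_pow_mul {h : ℂ → ℂ} (hh : Differentiable ℂ h) {ρ : ℂ} {n : ℕ}
    (hn : analyticOrderAt h ρ = n) :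
    ∃ g : ℂ → ℂ, Differentiable ℂ g ∧ (∀ z, h z = (z - ρ) ^ n * g z) ∧ g ρ ≠ 0 := by
  obtain ⟨g₀, hg₀, hg₀ρ, hev⟩ := ((hh.analyticAt ρ).analyticOrderAt_eq_natCast).1 hn
  classical
  set g : ℂ → ℂ := fun z => if z = ρ then g₀ ρ else h z / (z - ρ) ^ n with hg
  have hgev : g =ᶠ[𝓝 ρ] g₀ := by
    filter_upwards [hev] with z hz
    by_cases hzρ : z = ρ
    · simp [hg, hzρ]
    · have : z - ρ ≠ 0 := sub_ne_zero.2 hzρ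
      simp only [hg, if_neg hzρ, hz, smul_eq_mul]
      field_simp
  refine ⟨g, fun z => ?_, fun z => ?_, by simpa [hg] using hg₀ρ⟩
  · by_cases hzρ : z = ρ
    · rw [hzρ]
      exact hgev.differentiableAt_iff.2 hg₀.differentiableAt
    · have h1 : g =ᶠ[𝓝 z] fun z => h z / (z - ρ) ^ n := by
        filter_upwards [isOpen_ne.mem_nhds hzρ] with u hu
        simp only [hg, if_neg hu]
      refine h1.differentiableAt_iff.2 ((hh z).div (by fun_prop) (pow_ne_zero n ?_))
      exact sub_ne_zero.2 hzρ
  · by_cases hzρ : z = ρ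
    · have h1 := hev.self_of_nhds
      rw [hzρ, h1, hgev.eq_of_nhds, smul_eq_mul]
    · have : z - ρ ≠ 0 := sub_ne_zero.2 hzρ
      simp only [hg, if_neg hzρ]
      field_simp

/-- The normalised polynomial `∏ (1 - z / ρ) ^ m(ρ)` over a finite set of zeros of `f`. -/
noncomputable def zeroPoly (f : ℂ → ℂ) (T : Finset {ρ : ℂ // f ρ = 0}) (z : ℂ) : ℂ :=
  ∏ ρ ∈ T, (1 - z / (ρ : ℂ)) ^ analyticOrderNatAt f (ρ : ℂ)

/-- The number of zeros in a finite set, counted with multiplicity. -/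
noncomputable def zeroCount (f : ℂ → ℂ) (T : Finset {ρ : ℂ // f ρ = 0}) : ℕ :=
  ∑ ρ ∈ T, analyticOrderNatAt f (ρ : ℂ)

section Zeros

variable {f : ℂ → ℂ}

theorem differentiable_zeroPoly (T : Finset {ρ : ℂ // f ρ = 0}) :
    Differentiable ℂ (zeroPoly f T) := by
  unfold zeroPoly
  exact Differentiable.fun_finsetProd fun ρ _ => by fun_prop

theorem zero_ne_of_ne_zero (h0 : f 0 ≠ 0) (ρ : {ρ : ℂ // f ρ = 0}) : (ρ : ℂ) ≠ 0 := by
  intro h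
  have := ρ.2
  rw [h] at this
  exact h0 this

theorem zeroPoly_ne_zero (h0 : f 0 ≠ 0) (T : Finset {ρ : ℂ // f ρ = 0}) {z : ℂ}
    (hz : ∀ ρ ∈ T, z ≠ ρ) : zeroPoly f T z ≠ 0 := by
  refine Finset.prod_ne_zero_iff.2 fun ρ hρ => pow_ne_zero _ ?_
  have := zero_ne_of_ne_zero h0 ρ
  rw [sub_ne_zero, ne_comm, Ne, div_eq_one_iff_eq this]
  exact hz ρ hρ

/-- The zeros in `T`, with their full multiplicities, can be divided out of `f`: the quotient is
entire and no longer vanishes on `T`. -/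
theorem exists_eq_zeroPoly_mul (hf : Differentiable ℂ f) (h0 : f 0 ≠ 0)
    (T : Finset {ρ : ℂ // f ρ = 0}) :
    ∃ g : ℂ → ℂ, Differentiable ℂ g ∧ (∀ z, f z = zeroPoly f T z * g z) ∧
      ∀ ρ ∈ T, g (ρ : ℂ) ≠ 0 := by
  classical
  induction T using Finset.induction_on with
  | empty => exact ⟨f, hf, by simp [zeroPoly], by simp⟩
  | insert ρ T hρT ih =>
    obtain ⟨g, hg, hfg, hgT⟩ := ih
    have hρ0 := zero_ne_of_ne_zero h0 ρ
    have hPρ : zeroPoly f T ρ ≠ 0 :=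
      zeroPoly_ne_zero h0 T fun τ hτ h => hρT (by rwa [Subtype.ext h])
    have hord : analyticOrderAt g (ρ : ℂ) = analyticOrderNatAt f (ρ : ℂ) := by
      have h1 : f = zeroPoly f T * g := funext hfg
      have hP := (differentiable_zeroPoly T).analyticAt (ρ : ℂ)
      have h2 : analyticOrderAt f (ρ : ℂ) = analyticOrderAt g (ρ : ℂ) := by
        refine (congrArg (fun u => analyticOrderAt u (ρ : ℂ)) h1).trans ?_
        rw [analyticOrderAt_mul hP (hg.analyticAt _),
          (hP.analyticOrderAt_eq_zero).2 hPρ, zero_add]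
      rw [← h2, Nat.cast_analyticOrderNatAt (analyticOrderAt_ne_top_of_differentiable hf h0 _)]
    obtain ⟨k, hk, hgk, hkρ⟩ := exists_differentiable_eq_pow_mul hg hord
    refine ⟨fun z => (-(ρ : ℂ)) ^ analyticOrderNatAt f (ρ : ℂ) * k z, by fun_prop,
      fun z => ?_, fun τ hτ => ?_⟩
    · have h3 : (z - (ρ : ℂ)) = (1 - z / ρ) * -(ρ : ℂ) := by field_simp; ring
      rw [hfg, hgk, zeroPoly, zeroPoly, Finset.prod_insert hρT, h3, mul_pow]
      ring
    · refine mul_ne_zero (pow_ne_zero _ (neg_ne_zero.2 hρ0)) ?_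
      rcases Finset.mem_insert.1 hτ with rfl | hτ
      · exact hkρ
      · have := hgT τ hτ
        rw [hgk] at this
        exact right_ne_zero_of_mul this

/-- If all zeros in `T` are small compared to `R`, dividing `f` by `zeroPoly f T` improves a bound
on the disc of radius `R` by `Λ` to the number of these zeros. -/
theorem norm_le_div_pow_zeroCount (h0 : f 0 ≠ 0) {T : Finset {ρ : ℂ // f ρ = 0}} {g : ℂ → ℂ}
    (hg : Differentiable ℂ g) (hfg : ∀ z, f z = zeroPoly f T z * g z) {R B Λ : ℝ} (hR : 0 < R)
    (hΛ : 0 < Λ) (hT : ∀ ρ ∈ T, (Λ + 1) * ‖(ρ : ℂ)‖ ≤ R) (hB : ∀ z, ‖z‖ ≤ R → ‖f z‖ ≤ B)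
    {z : ℂ} (hz : ‖z‖ ≤ R) : ‖g z‖ ≤ B / Λ ^ zeroCount f T := by
  refine Complex.norm_le_of_forall_mem_frontier_norm_le (U := Metric.ball 0 R)
    Metric.isBounded_ball hg.diffContOnCl (fun w hw => ?_)
    (by rw [closure_ball _ hR.ne']; simpa using hz)
  rw [frontier_ball _ hR.ne', mem_sphere_zero_iff_norm] at hw
  rw [le_div_iff₀ (by positivity)]
  have hP : Λ ^ zeroCount f T ≤ ‖zeroPoly f T w‖ := by
    rw [zeroPoly, zeroCount, norm_prod, ← Finset.prod_pow_eq_pow_sum]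
    refine Finset.prod_le_prod (fun _ _ => by positivity) fun ρ hρ => ?_
    rw [norm_pow]
    gcongr
    have hρ0 : 0 < ‖(ρ : ℂ)‖ := norm_pos_iff.2 (zero_ne_of_ne_zero h0 ρ)
    have h1 : ‖w / (ρ : ℂ)‖ - ‖(1 : ℂ)‖ ≤ ‖1 - w / (ρ : ℂ)‖ := by
      rw [norm_sub_rev]; exact norm_sub_norm_le _ _
    have h2 : Λ + 1 ≤ ‖w / (ρ : ℂ)‖ := by
      rw [norm_div, hw, le_div_iff₀ hρ0]
      exact hT ρ hρ
    rw [norm_one] at h1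
    linarith
  calc ‖g w‖ * Λ ^ zeroCount f T ≤ ‖g w‖ * ‖zeroPoly f T w‖ := by gcongr
    _ = ‖f w‖ := by rw [hfg w, norm_mul, mul_comm]
    _ ≤ B := hB w hw.le

theorem zeroPoly_zero (T : Finset {ρ : ℂ // f ρ = 0}) : zeroPoly f T 0 = 1 := by
  simp [zeroPoly]

/-- Jensen-type bound on the number of zeros in a disc. -/
theorem zeroCount_le (hf : Differentiable ℂ f) (h0 : f 0 ≠ 0) {T : Finset {ρ : ℂ // f ρ = 0}}
    {R A : ℝ} (hR : 0 < R) (hT : ∀ ρ ∈ T, ‖(ρ : ℂ)‖ ≤ R)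
    (hB : ∀ z, ‖z‖ ≤ 4 * R → ‖f z‖ ≤ Real.exp A * ‖f 0‖) : (zeroCount f T : ℝ) ≤ A := by
  obtain ⟨g, hg, hfg, -⟩ := exists_eq_zeroPoly_mul hf h0 T
  have h1 := norm_le_div_pow_zeroCount h0 hg hfg (R := 4 * R) (Λ := 3) (by positivity)
    (by norm_num) (fun ρ hρ => by linarith [hT ρ hρ]) hB (z := 0) (by simp; positivity)
  have hg0 : g 0 = f 0 := by rw [hfg 0, zeroPoly_zero, one_mul]
  rw [hg0, le_div_iff₀ (by positivity), mul_comm] at h1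
  have h2 := le_of_mul_le_mul_right h1 (norm_pos_iff.2 h0)
  refine Real.exp_le_exp.1 (le_trans ?_ h2)
  rw [← mul_one (zeroCount f T : ℝ), Real.exp_nat_mul]
  gcongr
  exact Real.exp_one_lt_three.le

theorem finite_zeros_norm_le (hf : Differentiable ℂ f) (h0 : f 0 ≠ 0) (R : ℝ) :
    {ρ : {ρ : ℂ // f ρ = 0} | ‖(ρ : ℂ)‖ ≤ R}.Finite := by
  have hfin : {z : ℂ | f z = 0 ∧ ‖z‖ ≤ R}.Finite := by
    by_contra hinf
    obtain ⟨z, -, hz⟩ := Set.Infinite.exists_accPt_of_subset_isCompact hinf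
      (isCompact_closedBall (0 : ℂ) R) fun z hz => by simpa using hz.2
    have han : AnalyticOnNhd ℂ f Set.univ := fun z _ => hf.analyticAt z
    refine h0 (han.eqOn_zero_of_preconnected_of_frequently_eq_zero isPreconnected_univ
      (Set.mem_univ z) ?_ (Set.mem_univ 0))
    exact (accPt_iff_frequently_nhdsNE.1 hz).mono fun w hw => hw.1
  refine Set.Finite.of_finite_image (f := Subtype.val) (hfin.subset ?_)
    Subtype.val_injective.injOn
  rintro _ ⟨ρ, hρ, rfl⟩
  exact ⟨ρ.2, hρ⟩

theorem tendsto_norm_zeros_cofinite (hf : Differentiable ℂ f) (h0 : f 0 ≠ 0) :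
    Tendsto (fun ρ : {ρ : ℂ // f ρ = 0} => ‖(ρ : ℂ)‖) cofinite atTop := by
  refine tendsto_atTop.2 fun R => ?_
  filter_upwards [(finite_zeros_norm_le hf h0 R).compl_mem_cofinite] with ρ hρ
  exact (not_le.1 (show ¬ ‖(ρ : ℂ)‖ ≤ R from hρ)).le

/-- Growth of order `1` in the form used to count zeros. -/
theorem exists_exp_bound {K a : ℝ} (hK : 0 < K) (h0 : f 0 ≠ 0) (ha : 0 < a)
    (hb : ∀ z : ℂ, ‖f z‖ ≤ K * Real.exp (‖z‖ ^ a)) :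
    ∃ A : ℝ, 0 < A ∧ ∀ R : ℝ, ∀ z : ℂ, ‖z‖ ≤ R → ‖f z‖ ≤ Real.exp (R ^ a + A) * ‖f 0‖ := by
  have hf0 : 0 < ‖f 0‖ := norm_pos_iff.2 h0
  refine ⟨max 1 (Real.log (K / ‖f 0‖)), by positivity, fun R z hz => ?_⟩
  have h1 : K ≤ Real.exp (max 1 (Real.log (K / ‖f 0‖))) * ‖f 0‖ := by
    rw [← div_le_iff₀ hf0, ← Real.log_le_iff_le_exp (by positivity)]
    exact le_max_right _ _
  calc ‖f z‖ ≤ K * Real.exp (‖z‖ ^ a) := hb z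
    _ ≤ (Real.exp (max 1 (Real.log (K / ‖f 0‖))) * ‖f 0‖) * Real.exp (R ^ a) := by gcongr
    _ = _ := by rw [Real.exp_add]; ring

/-- The exponent of convergence of the zeros is at most `1`: dyadic summation of the bound on the
number of zeros. -/
theorem summable_zeros_rpow (hf : Differentiable ℂ f) (h0 : f 0 ≠ 0)
    (hb : ∀ a : ℝ, 1 < a → ∃ K : ℝ, 0 < K ∧ ∀ z : ℂ, ‖f z‖ ≤ K * Real.exp (‖z‖ ^ a))
    {σ : ℝ} (hσ : 1 < σ) :
    Summable fun ρ : {ρ : ℂ // f ρ = 0} =>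
      (analyticOrderNatAt f (ρ : ℂ) : ℝ) * ‖(ρ : ℂ)‖ ^ (-σ) := by
  classical
  obtain ⟨a, ha1, haσ⟩ := exists_between hσ
  obtain ⟨K, hK, hKb⟩ := hb a ha1
  obtain ⟨A, hA, hAb⟩ := exists_exp_bound hK h0 (by linarith) hKb
  obtain ⟨r, hr, hrz⟩ : ∃ r > 0, ∀ z : ℂ, ‖z‖ < r → f z ≠ 0 := by
    obtain ⟨r, hr, h⟩ := Metric.eventually_nhds_iff.1
      (hf.continuous.continuousAt.eventually_ne h0)
    exact ⟨r, hr, fun z hz => h (by simpa using hz)⟩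
  set m : {ρ : ℂ // f ρ = 0} → ℝ := fun ρ => (analyticOrderNatAt f (ρ : ℂ) : ℝ) with hm
  have hcount : ∀ (T : Finset {ρ : ℂ // f ρ = 0}) (k : ℕ),
      (∀ ρ ∈ T, ‖(ρ : ℂ)‖ ≤ r * 2 ^ k) → ∑ ρ ∈ T, m ρ ≤ ((4 * r) ^ a + A) * ((2 : ℝ) ^ a) ^ k := by
    intro T k hT
    have h1 := zeroCount_le hf h0 (A := (4 * (r * 2 ^ k)) ^ a + A)
      (by positivity) hT (fun z hz => hAb _ z hz)
    rw [zeroCount] at h1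
    push_cast at h1
    refine h1.trans ?_
    have h2 : (4 * (r * 2 ^ k)) ^ a = (4 * r) ^ a * ((2 : ℝ) ^ a) ^ k := by
      rw [← mul_assoc, Real.mul_rpow (by positivity) (by positivity), ← Real.rpow_natCast,
        ← Real.rpow_natCast, ← Real.rpow_mul (by norm_num), ← Real.rpow_mul (by norm_num),
        mul_comm (k : ℝ) a]
    have h3 : 1 ≤ ((2 : ℝ) ^ a) ^ k :=
      one_le_pow₀ (Real.one_le_rpow (by norm_num) (by linarith))
    rw [h2, add_mul]
    nlinarith
  set θ : ℝ := (2 : ℝ) ^ a * (2 : ℝ) ^ (-σ) with hθ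
  have hθ0 : 0 ≤ θ := by positivity
  have hθ1 : θ < 1 := by
    rw [hθ, ← Real.rpow_add (by norm_num)]
    exact Real.rpow_lt_one_of_one_lt_of_neg (by norm_num) (by linarith)
  -- each term is dominated by the dyadic scales above it
  have hterm : ∀ ρ : {ρ : ℂ // f ρ = 0}, ∃ k : ℕ, ‖(ρ : ℂ)‖ ≤ r * 2 ^ k ∧
      ‖(ρ : ℂ)‖ ^ (-σ) ≤ (r / 2) ^ (-σ) * ((2 : ℝ) ^ (-σ)) ^ k := by
    intro ρ
    have hρr : r ≤ ‖(ρ : ℂ)‖ := not_lt.1 fun h => hrz _ h ρ.2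
    obtain ⟨n, hn1, hn2⟩ := exists_nat_pow_near ((one_le_div hr).2 hρr) (one_lt_two (α := ℝ))
    refine ⟨n + 1, ?_, ?_⟩
    · rw [div_lt_iff₀ hr] at hn2
      linarith
    · rw [le_div_iff₀ hr] at hn1
      have h1 : (r / 2) ^ (-σ) * ((2 : ℝ) ^ (-σ)) ^ (n + 1) = (r / 2 * 2 ^ (n + 1)) ^ (-σ) := by
        rw [Real.mul_rpow (by positivity) (by positivity), ← Real.rpow_natCast,
          ← Real.rpow_natCast, ← Real.rpow_mul (by norm_num), ← Real.rpow_mul (by norm_num),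
          mul_comm (-σ)]
      rw [h1]
      refine Real.rpow_le_rpow_of_nonpos (by positivity) ?_ (by linarith)
      rw [pow_succ]
      linarith
  choose k hk1 hk2 using hterm
  refine summable_of_sum_le (c := (r / 2) ^ (-σ) * ((4 * r) ^ a + A) * (1 - θ)⁻¹)
    (fun ρ => by positivity) fun T => ?_
  set N := T.sup k + 1 with hN
  have hmaps : ∀ ρ ∈ T, k ρ ∈ Finset.range N := fun ρ hρ =>
    Finset.mem_range.2 (Nat.lt_succ_of_le (Finset.le_sup hρ))
  rw [← Finset.sum_fiberwise_of_maps_to hmaps]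
  calc ∑ j ∈ Finset.range N, ∑ ρ ∈ T with k ρ = j, m ρ * ‖(ρ : ℂ)‖ ^ (-σ)
      ≤ ∑ j ∈ Finset.range N, (r / 2) ^ (-σ) * ((4 * r) ^ a + A) * θ ^ j := by
        refine Finset.sum_le_sum fun j _ => ?_
        calc ∑ ρ ∈ T with k ρ = j, m ρ * ‖(ρ : ℂ)‖ ^ (-σ)
            ≤ ∑ ρ ∈ T with k ρ = j, m ρ * ((r / 2) ^ (-σ) * ((2 : ℝ) ^ (-σ)) ^ j) := by
              refine Finset.sum_le_sum fun ρ hρ => ?_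
              have := hk2 ρ
              rw [(Finset.mem_filter.1 hρ).2] at this
              gcongr
          _ = (∑ ρ ∈ T with k ρ = j, m ρ) * ((r / 2) ^ (-σ) * ((2 : ℝ) ^ (-σ)) ^ j) := by
              rw [Finset.sum_mul]
          _ ≤ (((4 * r) ^ a + A) * ((2 : ℝ) ^ a) ^ j) *
                ((r / 2) ^ (-σ) * ((2 : ℝ) ^ (-σ)) ^ j) := by
              gcongr
              refine hcount _ j fun ρ hρ => ?_
              have := hk1 ρ
              rwa [(Finset.mem_filter.1 hρ).2] at this
          _ = _ := by rw [hθ, mul_pow]; ring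
    _ = (r / 2) ^ (-σ) * ((4 * r) ^ a + A) * ∑ j ∈ Finset.range N, θ ^ j := by
        rw [Finset.mul_sum]
    _ ≤ _ := by
        gcongr
        exact (Summable.sum_le_tsum _ (fun _ _ => by positivity)
          (summable_geometric_of_lt_one hθ0 hθ1)).trans_eq (tsum_geometric_of_lt_one hθ0 hθ1)

theorem logDeriv_zeroPoly (h0 : f 0 ≠ 0) (T : Finset {ρ : ℂ // f ρ = 0}) {z : ℂ}
    (hz : ∀ ρ ∈ T, z ≠ ρ) :
    logDeriv (zeroPoly f T) z = ∑ ρ ∈ T, (analyticOrderNatAt f (ρ : ℂ) : ℂ) / (z - ρ) := by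
  have hne : ∀ ρ ∈ T, (1 - z / (ρ : ℂ)) ≠ 0 := fun ρ hρ h => by
    have := zero_ne_of_ne_zero h0 ρ
    rw [sub_eq_zero, eq_comm, div_eq_one_iff_eq this] at h
    exact hz ρ hρ h
  refine (logDeriv_prod (f := fun (ρ : {ρ : ℂ // f ρ = 0}) (z : ℂ) =>
    (1 - z / (ρ : ℂ)) ^ analyticOrderNatAt f (ρ : ℂ))
    (fun ρ hρ => pow_ne_zero _ (hne ρ hρ)) (fun ρ _ => by fun_prop)).trans ?_
  refine Finset.sum_congr rfl fun ρ hρ => ?_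
  have hρ0 := zero_ne_of_ne_zero h0 ρ
  rw [logDeriv_fun_pow (by fun_prop), logDeriv_apply]
  have hd : deriv (fun z : ℂ => 1 - z / (ρ : ℂ)) z = -(1 / (ρ : ℂ)) := by
    simp
  have h2 : z - (ρ : ℂ) ≠ 0 := sub_ne_zero.2 (hz ρ hρ)
  have h3 := hne ρ hρ
  rw [hd, show (1 - z / (ρ : ℂ)) = -(z - ρ) / ρ by field_simp; ring]
  field_simp

/-- The second logarithmic derivative of `f` differs from the contribution of the zeros of norm at
most `2 R` by `O(log (max ‖f‖) / R²)`, the maximum being taken on the disc of radius `4 R`. -/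
theorem norm_deriv_logDeriv_add_sum_le (hf : Differentiable ℂ f) (h0 : f 0 ≠ 0)
    {T : Finset {ρ : ℂ // f ρ = 0}} {R A : ℝ} (hR : 0 < R) (hA : 0 < A)
    (hT : ∀ ρ, ρ ∈ T ↔ ‖(ρ : ℂ)‖ ≤ 2 * R)
    (hB : ∀ z, ‖z‖ ≤ 4 * R → ‖f z‖ ≤ Real.exp A * ‖f 0‖) {z : ℂ} (hz : ‖z‖ ≤ R / 2)
    (hfz : f z ≠ 0) :
    ‖deriv (logDeriv f) z + ∑ ρ ∈ T, (analyticOrderNatAt f (ρ : ℂ) : ℂ) * ((z - ρ) ^ 2)⁻¹‖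
      ≤ 64 * A / R ^ 2 := by
  obtain ⟨g, hg, hfg, hgT⟩ := exists_eq_zeroPoly_mul hf h0 T
  have hg0 : g 0 = f 0 := by rw [hfg 0, zeroPoly_zero, one_mul]
  have hgb : ∀ w ∈ Metric.ball (0 : ℂ) (2 * R), ‖g w‖ ≤ Real.exp A * ‖g 0‖ := by
    intro w hw
    rw [mem_ball_zero_iff] at hw
    have := norm_le_div_pow_zeroCount h0 hg hfg (R := 4 * R) (Λ := 1) (by positivity)
      one_pos (fun ρ hρ => by linarith [(hT ρ).1 hρ]) hB (z := w) (by linarith)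
    rwa [one_pow, div_one, ← hg0] at this
  have hgne : ∀ w ∈ Metric.ball (0 : ℂ) (2 * R), g w ≠ 0 := by
    intro w hw h
    rw [mem_ball_zero_iff] at hw
    have hfw : f w = 0 := by rw [hfg, h, mul_zero]
    exact hgT ⟨w, hfw⟩ ((hT _).2 hw.le) h
  have hgd := (norm_logDeriv_le_of_ball (by positivity) hA hg.differentiableOn hgne hgb (w := z)
    (by rw [sub_zero]; linarith)).2
  have hPz : ∀ w, f w ≠ 0 → ∀ ρ ∈ T, w ≠ (ρ : ℂ) := fun w hw ρ _ h => hw (h ▸ ρ.2)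
  have hev : ∀ᶠ w in 𝓝 z, f w ≠ 0 := hf.continuous.continuousAt.eventually_ne hfz
  have hlog : logDeriv f =ᶠ[𝓝 z] fun w =>
      (∑ ρ ∈ T, (analyticOrderNatAt f (ρ : ℂ) : ℂ) / (w - ρ)) + logDeriv g w := by
    filter_upwards [hev] with w hw
    have hgw : g w ≠ 0 := fun h => hw (by rw [hfg, h, mul_zero])
    have h1 : f = fun w => zeroPoly f T w * g w := funext hfg
    refine (congrArg (fun u => logDeriv u w) h1).trans ?_
    rw [logDeriv_mul w (zeroPoly_ne_zero h0 T (hPz w hw)) hgw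
      (differentiable_zeroPoly T w) (hg w), logDeriv_zeroPoly h0 T (hPz w hw)]
  have hgz : g z ≠ 0 := fun h => hfz (by rw [hfg, h, mul_zero])
  have hlg : DifferentiableAt ℂ (logDeriv g) z :=
    ((hg.analyticAt z).deriv.div (hg.analyticAt z) hgz).differentiableAt
  have hsum : HasDerivAt (fun w => ∑ ρ ∈ T, (analyticOrderNatAt f (ρ : ℂ) : ℂ) / (w - ρ))
      (∑ ρ ∈ T, -((analyticOrderNatAt f (ρ : ℂ) : ℂ) * ((z - ρ) ^ 2)⁻¹)) z := by
    refine HasDerivAt.fun_sum fun ρ hρ => ?_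
    have h2 : z - (ρ : ℂ) ≠ 0 := sub_ne_zero.2 (hPz z hfz ρ hρ)
    have h3 := (((hasDerivAt_id z).sub_const (ρ : ℂ)).inv h2).const_mul
      (analyticOrderNatAt f (ρ : ℂ) : ℂ)
    simp only [id, Pi.inv_apply, ← div_eq_mul_inv] at h3
    refine h3.congr_deriv ?_
    field_simp
  have hder : deriv (logDeriv f) z = (∑ ρ ∈ T,
      -((analyticOrderNatAt f (ρ : ℂ) : ℂ) * ((z - ρ) ^ 2)⁻¹)) + deriv (logDeriv g) z := by
    rw [hlog.deriv_eq]
    exact (hsum.add hlg.hasDerivAt).deriv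
  rw [hder, Finset.sum_neg_distrib]
  calc _ = ‖deriv (logDeriv g) z‖ := by congr 1; ring
    _ ≤ 256 * A / (2 * R) ^ 2 := hgd
    _ = _ := by ring

theorem norm_sub_isBigO_zeros (hf : Differentiable ℂ f) (h0 : f 0 ≠ 0) (x : ℂ) {σ : ℝ}
    (hσ : 0 ≤ σ) :
    (fun ρ : {ρ : ℂ // f ρ = 0} => (analyticOrderNatAt f (ρ : ℂ) : ℝ) * ‖x - (ρ : ℂ)‖ ^ (-σ))
      =O[cofinite] fun ρ : {ρ : ℂ // f ρ = 0} =>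
        (analyticOrderNatAt f (ρ : ℂ) : ℝ) * ‖(ρ : ℂ)‖ ^ (-σ) := by
  refine (isBigO_refl _ _).mul (IsBigO.of_bound ((1 / 2 : ℝ) ^ (-σ)) ?_)
  filter_upwards [(tendsto_norm_zeros_cofinite hf h0).eventually_ge_atTop (2 * ‖x‖ + 1)] with ρ hρ
  have hx := norm_nonneg x
  have h1 : 1 / 2 * ‖(ρ : ℂ)‖ ≤ ‖x - (ρ : ℂ)‖ := by
    have := norm_sub_norm_le (ρ : ℂ) x
    rw [norm_sub_rev] at this
    linarith
  rw [Real.norm_of_nonneg (by positivity), Real.norm_of_nonneg (by positivity),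
    ← Real.mul_rpow (by positivity) (by positivity)]
  exact Real.rpow_le_rpow_of_nonpos (by linarith) h1 (by linarith)

theorem summable_zeros_sub_rpow (hf : Differentiable ℂ f) (h0 : f 0 ≠ 0)
    (hb : ∀ a : ℝ, 1 < a → ∃ K : ℝ, 0 < K ∧ ∀ z : ℂ, ‖f z‖ ≤ K * Real.exp (‖z‖ ^ a))
    (x : ℂ) {σ : ℝ} (hσ : 1 < σ) :
    Summable fun ρ : {ρ : ℂ // f ρ = 0} =>
      (analyticOrderNatAt f (ρ : ℂ) : ℝ) * ‖x - (ρ : ℂ)‖ ^ (-σ) :=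
  summable_of_isBigO (summable_zeros_rpow hf h0 hb hσ)
    (norm_sub_isBigO_zeros hf h0 x (by linarith))

/-- The partial fraction expansion of the second logarithmic derivative of an entire function of
order one. -/
theorem hasSum_zeros_inv_sq (hf : Differentiable ℂ f) (h0 : f 0 ≠ 0)
    (hb : ∀ a : ℝ, 1 < a → ∃ K : ℝ, 0 < K ∧ ∀ z : ℂ, ‖f z‖ ≤ K * Real.exp (‖z‖ ^ a))
    {z : ℂ} (hz : f z ≠ 0) :
    HasSum (fun ρ : {ρ : ℂ // f ρ = 0} =>
      (analyticOrderNatAt f (ρ : ℂ) : ℂ) * ((z - ρ) ^ 2)⁻¹) (-deriv (logDeriv f) z) := by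
  have hsum : Summable fun ρ : {ρ : ℂ // f ρ = 0} =>
      (analyticOrderNatAt f (ρ : ℂ) : ℂ) * ((z - ρ) ^ 2)⁻¹ := by
    refine Summable.of_norm ((summable_zeros_sub_rpow hf h0 hb z one_lt_two).congr fun ρ => ?_)
    rw [norm_mul, Complex.norm_natCast, norm_inv, norm_pow, Real.rpow_neg (norm_nonneg _),
      Real.rpow_two]
  set T : ℕ → Finset {ρ : ℂ // f ρ = 0} := fun n =>
    (finite_zeros_norm_le hf h0 (2 * (n : ℝ))).toFinset with hTdef
  have hT : ∀ n ρ, ρ ∈ T n ↔ ‖(ρ : ℂ)‖ ≤ 2 * (n : ℝ) := fun n ρ => by simp [hTdef]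
  have hTtop : Tendsto T atTop atTop := by
    refine tendsto_atTop_finset_of_monotone (fun n m hnm ρ hρ => ?_) fun ρ => ?_
    · rw [hT] at hρ ⊢
      exact hρ.trans (by gcongr)
    · obtain ⟨n, hn⟩ := exists_nat_ge ‖(ρ : ℂ)‖
      exact ⟨n, (hT n ρ).2 (by have := norm_nonneg (ρ : ℂ); linarith)⟩
  have hlim1 := hsum.hasSum.comp hTtop
  obtain ⟨K, hK, hKb⟩ := hb (3 / 2) (by norm_num)
  obtain ⟨A, hA, hAb⟩ := exists_exp_bound hK h0 (by norm_num) hKb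
  have hlim2 : Tendsto (fun n : ℕ => deriv (logDeriv f) z +
      ∑ ρ ∈ T n, (analyticOrderNatAt f (ρ : ℂ) : ℂ) * ((z - ρ) ^ 2)⁻¹) atTop (𝓝 0) := by
    refine squeeze_zero_norm'
      (a := fun n : ℕ => 64 * (4 : ℝ) ^ (3 / 2 : ℝ) * (n : ℝ) ^ (-(1 / 2) : ℝ)
        + 64 * A * ((n : ℝ) ^ 2)⁻¹) ?_ ?_
    · filter_upwards [eventually_gt_atTop 0,
        (tendsto_natCast_atTop_atTop (R := ℝ)).eventually_ge_atTop (2 * ‖z‖)] with n hn hnz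
      have hn' : (0 : ℝ) < n := by exact_mod_cast hn
      refine (norm_deriv_logDeriv_add_sum_le hf h0 hn' (A := (4 * (n : ℝ)) ^ (3 / 2 : ℝ) + A)
        (by positivity) (hT n) (fun w hw => hAb _ w hw) (by linarith) hz).trans (le_of_eq ?_)
      have h1 : (n : ℝ) ^ (-(1 / 2) : ℝ) = (n : ℝ) ^ (3 / 2 : ℝ) / (n : ℝ) ^ 2 := by
        rw [← Real.rpow_two, ← Real.rpow_sub hn']
        norm_num
      rw [h1, Real.mul_rpow (by norm_num) hn'.le]
      ring
    · have h1 : Tendsto (fun n : ℕ => (n : ℝ) ^ (-(1 / 2) : ℝ)) atTop (𝓝 0) :=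
        (tendsto_rpow_neg_atTop (by norm_num)).comp tendsto_natCast_atTop_atTop
      have h2 : Tendsto (fun n : ℕ => ((n : ℝ) ^ 2)⁻¹) atTop (𝓝 0) :=
        tendsto_inv_atTop_zero.comp
          ((tendsto_pow_atTop two_ne_zero).comp tendsto_natCast_atTop_atTop)
      simpa using (h1.const_mul (64 * (4 : ℝ) ^ (3 / 2 : ℝ))).add (h2.const_mul (64 * A))
  have hlim3 := hlim1.const_add (deriv (logDeriv f) z)
  have := tendsto_nhds_unique hlim2 hlim3
  rw [neg_eq_of_add_eq_zero_right this.symm]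
  exact hsum.hasSum

end Zeros

/-! ### Decay of `L'/L` and expansion of `G'/G` along horizontal lines -/

theorem one_lt_re_of_mem_ball {x : ℝ} (hx : 4 ≤ x) {w : ℂ}
    (hw : w ∈ Metric.ball (x : ℂ) (x / 2)) :
    x / 2 < w.re ∧ ‖w‖ ≤ 2 * x := by
  rw [mem_ball_iff_norm] at hw
  have h1 := (Complex.abs_re_le_norm (w - x)).trans_lt hw
  rw [Complex.sub_re, Complex.ofReal_re, abs_lt] at h1
  refine ⟨by linarith, ?_⟩
  have h2 := norm_le_norm_sub_add w (x : ℂ)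
  rw [Complex.norm_of_nonneg (by linarith)] at h2
  linarith

theorem ne_one_of_one_lt_re {z : ℂ} (hz : 1 < z.re) : z ≠ 1 := by
  rintro rfl
  simp at hz

namespace IsPrimaryFunction

variable {L G Ξ : ℂ → ℂ} {q : ℕ} (hL : IsPrimaryFunction L G Ξ q)

include hL

theorem Xi_zero_ne_zero : Ξ 0 ≠ 0 := fun h => by simpa using (hL.zeros_Xi 0 h).1

theorem tendsto_L_atTop : Tendsto (fun x : ℝ => L x) atTop (𝓝 1) := by
  have h := hL.log_decay 0 1
  simp only [iteratedDeriv_zero] at h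
  have h1 : Tendsto (fun x : ℝ => x ^ (-((1 : ℕ) : ℤ))) atTop (𝓝 0) := by
    simpa using tendsto_inv_atTop_zero (𝕜 := ℝ)
  have h2 := (Complex.continuous_exp.tendsto 0).comp (h.trans_tendsto h1)
  rw [Complex.exp_zero] at h2
  refine h2.congr' ?_
  filter_upwards [eventually_gt_atTop 1] with x hx
  exact Complex.exp_log (hL.ne_zero _ (by simpa using hx))

/-- The decay of `log L` along the real axis, restated for `L'/L`. Near a large real point the
principal branch of `log L` is holomorphic, because `L → 1` there. -/
theorem iteratedDeriv_logDeriv_L_isBigO (N k : ℕ) :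
    (fun x : ℝ => iteratedDeriv k (logDeriv L) (x : ℂ)) =O[atTop] fun x : ℝ => x ^ (-(N : ℤ)) := by
  refine (hL.log_decay (k + 1) N).congr' ?_ EventuallyEq.rfl
  filter_upwards [eventually_gt_atTop 1,
    hL.tendsto_L_atTop.eventually (Complex.isOpen_slitPlane.mem_nhds Complex.one_mem_slitPlane)]
    with x hx hxs
  rw [iteratedDeriv_succ']
  refine Filter.EventuallyEq.iteratedDeriv_eq k ?_
  have hx1 : (x : ℂ) ≠ 1 := by exact_mod_cast hx.ne'
  have hc : ContinuousAt L x := (hL.analyticAt x hx1).continuousAt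
  filter_upwards [hc.eventually (Complex.isOpen_slitPlane.mem_nhds hxs), isOpen_ne.mem_nhds hx1]
    with z hz hz1
  rw [logDeriv_apply]
  exact ((hL.analyticAt z hz1).differentiableAt.hasDerivAt.clog hz).deriv

theorem differentiableOn_L_ball {x : ℝ} (hx : 4 ≤ x) :
    DifferentiableOn ℂ L (Metric.ball (x : ℂ) (x / 2)) := fun w hw =>
  (hL.analyticAt w (ne_one_of_one_lt_re (by
    have := (one_lt_re_of_mem_ball hx hw).1; linarith))).differentiableAt.differentiableWithinAt

theorem L_ne_zero_of_mem_ball {x : ℝ} (hx : 4 ≤ x) {w : ℂ}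
    (hw : w ∈ Metric.ball (x : ℂ) (x / 2)) : L w ≠ 0 :=
  hL.ne_zero w (by have := (one_lt_re_of_mem_ball hx hw).1; linarith)

/-- `L'/L` grows at most linearly on the balls `B(x, x/8)`, by the Borel–Carathéodory inequality
and the finite order of `G` and `Ξ`. -/
theorem eventually_norm_logDeriv_L_le :
    ∀ᶠ x : ℝ in atTop, ∀ w ∈ Metric.ball (x : ℂ) (x / 8), ‖logDeriv L w‖ ≤ 288 * x ^ 1 := by
  obtain ⟨K, hK, hKb⟩ := hL.order_G.exists_norm_le one_lt_two
  obtain ⟨K', hK', hKb'⟩ := hL.order_Xi.exists_norm_le one_lt_two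
  have hsq : Tendsto (fun x : ℝ => x ^ 2) atTop atTop := tendsto_pow_atTop two_ne_zero
  filter_upwards [eventually_ge_atTop 4, hsq.eventually_ge_atTop (Real.log (2 * (K * K'))),
    hL.tendsto_L_atTop.norm.eventually_const_lt (u := (1 / 2 : ℝ)) (by norm_num)]
    with x hx hxK hLx w hw
  rw [Real.log_le_iff_le_exp (by positivity)] at hxK
  have hb : ∀ w ∈ Metric.ball (x : ℂ) (x / 2), ‖L w‖ ≤ Real.exp (9 * x ^ 2) * ‖L x‖ := by
    intro w hw
    obtain ⟨hwre, hwn⟩ := one_lt_re_of_mem_ball hx hw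
    have hw1 : 1 ≤ ‖w - 1‖ := by
      refine le_trans ?_ (Complex.abs_re_le_norm (w - 1))
      rw [Complex.sub_re, Complex.one_re]
      exact le_trans (by linarith) (le_abs_self _)
    have hgr : Real.exp (‖w‖ ^ (2 : ℝ)) ≤ Real.exp (4 * x ^ 2) := by
      rw [Real.exp_le_exp, Real.rpow_two]
      nlinarith [norm_nonneg w]
    calc ‖L w‖ ≤ ‖w - 1‖ ^ q * ‖L w‖ := le_mul_of_one_le_left (norm_nonneg _) (one_le_pow₀ hw1)
      _ = ‖G w‖ * ‖Ξ w‖ := by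
          rw [← norm_pow, ← norm_mul, ← norm_mul,
            hL.factor w (ne_one_of_one_lt_re (by linarith))]
      _ ≤ (K * Real.exp (4 * x ^ 2)) * (K' * Real.exp (4 * x ^ 2)) := by
          gcongr
          · exact (hKb w).trans (by gcongr)
          · exact (hKb' w).trans (by gcongr)
      _ = (2 * (K * K')) * Real.exp (8 * x ^ 2) * (1 / 2) := by
          rw [show 8 * x ^ 2 = 4 * x ^ 2 + 4 * x ^ 2 by ring, Real.exp_add]; ring
      _ ≤ Real.exp (x ^ 2) * Real.exp (8 * x ^ 2) * ‖L x‖ := by gcongr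
      _ = _ := by rw [← Real.exp_add]; ring_nf
  have := (norm_logDeriv_le_of_ball (w := w) (by linarith) (by positivity)
    (hL.differentiableOn_L_ball hx) (fun w hw => hL.L_ne_zero_of_mem_ball hx hw) hb (by
      rw [mem_ball_iff_norm] at hw; linarith)).1
  refine this.trans (le_of_eq ?_)
  field_simp
  norm_num

theorem eventually_differentiableOn_logDeriv_L :
    ∀ᶠ x : ℝ in atTop, DifferentiableOn ℂ (logDeriv L) (Metric.ball (x : ℂ) (x / 8)) := by
  filter_upwards [eventually_ge_atTop 4] with x hx
  exact (((hL.differentiableOn_L_ball hx).deriv Metric.isOpen_ball).div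
    (hL.differentiableOn_L_ball hx) fun w hw => hL.L_ne_zero_of_mem_ball hx hw).mono
      (Metric.ball_subset_ball (by linarith))

/-- `L'/L` is rapidly decreasing along every horizontal line. -/
theorem logDeriv_L_isBigO (x : ℂ) (M : ℕ) :
    (fun y : ℝ => logDeriv L (x + y)) =O[atTop] fun y : ℝ => y ^ (-(M : ℤ)) := by
  obtain ⟨D, hD⟩ := eventually_norm_le_of_iteratedDeriv_isBigO
    hL.eventually_differentiableOn_logDeriv_L hL.eventually_norm_logDeriv_L_le
    (hL.iteratedDeriv_logDeriv_L_isBigO M) (r := ‖x‖ + 1) (by positivity)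
  refine IsBigO.of_bound D ?_
  filter_upwards [hD, eventually_ge_atTop 0] with y hy hy0
  rw [Real.norm_of_nonneg (by positivity)]
  exact hy _ (by simp)

theorem deriv_logDeriv_L_isBigO (x : ℂ) (M : ℕ) :
    (fun y : ℝ => deriv (logDeriv L) (x + y)) =O[atTop] fun y : ℝ => y ^ (-(M : ℤ)) := by
  obtain ⟨D, hD⟩ := eventually_norm_le_of_iteratedDeriv_isBigO
    hL.eventually_differentiableOn_logDeriv_L hL.eventually_norm_logDeriv_L_le
    (hL.iteratedDeriv_logDeriv_L_isBigO M) (r := ‖x‖ + 1) (by positivity)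
  refine IsBigO.of_bound D ?_
  filter_upwards [eventually_norm_deriv_le hL.eventually_differentiableOn_logDeriv_L hD,
    eventually_ge_atTop 0] with y hy hy0
  rw [Real.norm_of_nonneg (by positivity)]
  exact hy _ (by simp)

end IsPrimaryFunction

section Stirling

variable {G ℓ : ℂ → ℂ} {a₁ b₁ a₀ b₀ : ℂ} {a : ℕ → ℂ}

/-- The remainder of order `N` in the Stirling expansion of `-ℓ`, for a branch `ℓ` of `log G`. -/
noncomputable def stirlingRemainder (ℓ : ℂ → ℂ) (a₁ b₁ a₀ b₀ : ℂ) (a : ℕ → ℂ) (N : ℕ) (z : ℂ) : ℂ :=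
  -ℓ z - (a₁ * z * (Complex.log z - 1) + b₁ * z + a₀ * Complex.log z + b₀
    + ∑ n ∈ Finset.Icc 1 N, a n * z ^ (-(n : ℤ)))

theorem logDeriv_eq_deriv_of_exp_eq {z : ℂ} (hℓ : DifferentiableAt ℂ ℓ z)
    (h : ∀ᶠ w in 𝓝 z, Complex.exp (ℓ w) = G w) : logDeriv G z = deriv ℓ z := by
  have h1 : G =ᶠ[𝓝 z] fun w => Complex.exp (ℓ w) := h.mono fun _ hw => hw.symm
  rw [logDeriv_apply, h1.deriv_eq, h1.eq_of_nhds, hℓ.hasDerivAt.cexp.deriv,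
    mul_div_cancel_left₀ _ (Complex.exp_ne_zero _)]

theorem mem_slitPlane_of_re_pos {z : ℂ} (hz : 0 < z.re) : z ∈ Complex.slitPlane := Or.inl hz

theorem ne_zero_of_re_pos {z : ℂ} (hz : 0 < z.re) : z ≠ 0 :=
  Complex.slitPlane_ne_zero (mem_slitPlane_of_re_pos hz)

theorem isOpen_re_pos : IsOpen {z : ℂ | 0 < z.re} :=
  isOpen_lt continuous_const Complex.continuous_re

theorem deriv_stirlingRemainder (hd : DifferentiableOn ℂ ℓ {z : ℂ | 0 < z.re})
    (he : ∀ z : ℂ, 0 < z.re → Complex.exp (ℓ z) = G z) (N : ℕ) {z : ℂ} (hz : 0 < z.re) :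
    deriv (stirlingRemainder ℓ a₁ b₁ a₀ b₀ a N) z = -logDeriv G z
      - (a₁ * Complex.log z + b₁ + a₀ * z⁻¹
        + ∑ n ∈ Finset.Icc 1 N, a n * (-(n : ℂ) * z ^ (-(n : ℤ) - 1))) := by
  have hz0 := ne_zero_of_re_pos hz
  have hdz : DifferentiableAt ℂ ℓ z := (hd z hz).differentiableAt (isOpen_re_pos.mem_nhds hz)
  rw [logDeriv_eq_deriv_of_exp_eq hdz (by
    filter_upwards [isOpen_re_pos.mem_nhds hz] with w hw using he w hw)]
  have hlog : HasDerivAt Complex.log z⁻¹ z := Complex.hasDerivAt_log (mem_slitPlane_of_re_pos hz)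
  have hsum : HasDerivAt (fun z : ℂ => ∑ n ∈ Finset.Icc 1 N, a n * z ^ (-(n : ℤ)))
      (∑ n ∈ Finset.Icc 1 N, a n * (-(n : ℂ) * z ^ (-(n : ℤ) - 1))) z := by
    refine HasDerivAt.fun_sum fun n _ => ?_
    have := (hasDerivAt_zpow (-(n : ℤ)) z (Or.inl hz0)).const_mul (a n)
    simpa using this
  have h1 := ((((hasDerivAt_id z).const_mul a₁).mul (hlog.sub_const 1)).add
    ((hasDerivAt_id z).const_mul b₁)).add (hlog.const_mul a₀)
  have h2 := hdz.hasDerivAt.neg.sub ((h1.add_const b₀).add hsum)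
  refine h2.deriv.trans ?_
  simp only [id]
  field_simp
  ring

theorem differentiableAt_logDeriv_of_exp_eq
    (he : ∀ z : ℂ, 0 < z.re → Complex.exp (ℓ z) = G z)
    {z : ℂ} (hG : Differentiable ℂ G) (hz : 0 < z.re) :
    DifferentiableAt ℂ (logDeriv G) z :=
  ((hG.analyticAt z).deriv.div (hG.analyticAt z)
    (by rw [← he z hz]; exact Complex.exp_ne_zero _)).differentiableAt

theorem deriv_deriv_stirlingRemainder (hd : DifferentiableOn ℂ ℓ {z : ℂ | 0 < z.re})
    (he : ∀ z : ℂ, 0 < z.re → Complex.exp (ℓ z) = G z)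
    (hG : Differentiable ℂ G) (N : ℕ) {z : ℂ} (hz : 0 < z.re) :
    DifferentiableAt ℂ (deriv (stirlingRemainder ℓ a₁ b₁ a₀ b₀ a N)) z ∧
    deriv (deriv (stirlingRemainder ℓ a₁ b₁ a₀ b₀ a N)) z = -deriv (logDeriv G) z
      - (a₁ * z⁻¹ - a₀ * (z ^ 2)⁻¹
        + ∑ n ∈ Finset.Icc 1 N, a n * (n * (n + 1)) * (z ^ (n + 2))⁻¹) := by
  have hz0 := ne_zero_of_re_pos hz
  have hev : deriv (stirlingRemainder ℓ a₁ b₁ a₀ b₀ a N) =ᶠ[𝓝 z] fun z => -logDeriv G z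
      - (a₁ * Complex.log z + b₁ + a₀ * z⁻¹
        + ∑ n ∈ Finset.Icc 1 N, a n * (-(n : ℂ) * z ^ (-(n : ℤ) - 1))) := by
    filter_upwards [isOpen_re_pos.mem_nhds hz] with w hw using deriv_stirlingRemainder hd he N hw
  have hlog : HasDerivAt Complex.log z⁻¹ z := Complex.hasDerivAt_log (mem_slitPlane_of_re_pos hz)
  have hsum : HasDerivAt (fun z : ℂ => ∑ n ∈ Finset.Icc 1 N,
      a n * (-(n : ℂ) * z ^ (-(n : ℤ) - 1)))
      (∑ n ∈ Finset.Icc 1 N, a n * (n * (n + 1)) * (z ^ (n + 2))⁻¹) z := by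
    refine HasDerivAt.fun_sum fun n _ => ?_
    have h1 := ((hasDerivAt_zpow (-(n : ℤ) - 1) z (Or.inl hz0)).const_mul (-(n : ℂ))).const_mul
      (a n)
    refine h1.congr_deriv ?_
    rw [show (-(n : ℤ) - 1 - 1) = -((n + 2 : ℕ) : ℤ) by push_cast; ring, zpow_neg, zpow_natCast]
    push_cast
    ring
  have h2 := (((hlog.const_mul a₁).add_const b₁).add ((hasDerivAt_inv hz0).const_mul a₀)).add hsum
  have h3 := (differentiableAt_logDeriv_of_exp_eq he hG hz).hasDerivAt.neg.sub h2
  have h4 := h3.congr_of_eventuallyEq hev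
  refine ⟨h4.differentiableAt, h4.deriv.trans ?_⟩
  ring

/-- A crude bound for `log G` on the real axis, which gives the lower bound on `‖G x‖` that the
Borel–Carathéodory inequality requires. -/
theorem eventually_norm_branch_le
    (h : ∀ N k : ℕ, (fun x : ℝ => iteratedDeriv k (stirlingRemainder ℓ a₁ b₁ a₀ b₀ a N) (x : ℂ))
      =O[atTop] fun x : ℝ => x ^ (-((N + 1 + k : ℕ) : ℤ))) :
    ∃ C : ℝ, 0 < C ∧ ∀ᶠ x : ℝ in atTop, ‖ℓ x‖ ≤ C * x ^ 2 := by
  obtain ⟨C, hC0, hC⟩ := (h 0 0).exists_pos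
  refine ⟨C + 2 * ‖a₁‖ + ‖b₁‖ + ‖a₀‖ + ‖b₀‖, by positivity, ?_⟩
  rw [IsBigOWith] at hC
  filter_upwards [hC, eventually_ge_atTop 1] with x hx hx1
  have hx0 : 0 < x := by linarith
  have hlog : ‖Complex.log x‖ ≤ x := by
    rw [← Complex.ofReal_log hx0.le, Complex.norm_real,
      Real.norm_of_nonneg (Real.log_nonneg hx1)]
    exact (Real.log_le_sub_one_of_pos hx0).trans (by linarith)
  have hlog1 : ‖Complex.log x - 1‖ ≤ 2 * x := by
    refine (norm_sub_le _ _).trans ?_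
    rw [norm_one]
    linarith
  have hxn : ‖(x : ℂ)‖ = x := Complex.norm_of_nonneg hx0.le
  have hR : ‖stirlingRemainder ℓ a₁ b₁ a₀ b₀ a 0 x‖ ≤ C * x ^ 2 := by
    rw [iteratedDeriv_zero] at hx
    refine hx.trans ?_
    gcongr
    rw [Real.norm_of_nonneg (by positivity), zpow_neg]
    refine (inv_le_one_of_one_le₀ ?_).trans (one_le_pow₀ hx1)
    simpa using hx1
  have heq : ℓ x = -(stirlingRemainder ℓ a₁ b₁ a₀ b₀ a 0 x + (a₁ * x * (Complex.log x - 1)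
      + b₁ * x + a₀ * Complex.log x + b₀)) := by
    simp only [stirlingRemainder, zero_lt_one, Finset.Icc_eq_empty_of_lt, Finset.sum_empty]
    ring
  have hxx : x ≤ x ^ 2 := by nlinarith
  have h1x : 1 ≤ x ^ 2 := by nlinarith
  rw [heq, norm_neg]
  calc _ ≤ ‖stirlingRemainder ℓ a₁ b₁ a₀ b₀ a 0 x‖ + (‖a₁ * x * (Complex.log x - 1)‖
      + ‖b₁ * x‖ + ‖a₀ * Complex.log x‖ + ‖b₀‖) := by
        refine (norm_add_le _ _).trans (by gcongr; exact norm_add₄_le)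
    _ ≤ C * x ^ 2 + (‖a₁‖ * x * (2 * x) + ‖b₁‖ * x ^ 2 + ‖a₀‖ * x ^ 2 + ‖b₀‖ * x ^ 2) := by
        rw [norm_mul, norm_mul, norm_mul, norm_mul, hxn]
        gcongr
        · exact hlog.trans hxx
        · exact le_mul_of_one_le_right (norm_nonneg _) h1x
    _ = _ := by ring

/-- `G'/G` grows at most linearly on the balls `B(x, x/8)`, by the Borel–Carathéodory inequality
and the finite order of `G`. -/
theorem eventually_norm_logDeriv_G_le (he : ∀ z : ℂ, 0 < z.re → Complex.exp (ℓ z) = G z)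
    (hG : IsEntireOfOrder G 1)
    (h : ∀ N k : ℕ, (fun x : ℝ => iteratedDeriv k (stirlingRemainder ℓ a₁ b₁ a₀ b₀ a N) (x : ℂ))
      =O[atTop] fun x : ℝ => x ^ (-((N + 1 + k : ℕ) : ℤ))) :
    ∃ C : ℝ, 0 < C ∧ ∀ᶠ x : ℝ in atTop, ∀ w ∈ Metric.ball (x : ℂ) (x / 8),
      ‖logDeriv G w‖ ≤ C * x := by
  obtain ⟨K, hK, hKb⟩ := hG.exists_norm_le one_lt_two
  obtain ⟨C, hC, hCb⟩ := eventually_norm_branch_le h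
  have hsq : Tendsto (fun x : ℝ => x ^ 2) atTop atTop := tendsto_pow_atTop two_ne_zero
  refine ⟨32 * (5 + C), by positivity, ?_⟩
  filter_upwards [eventually_ge_atTop 4, hsq.eventually_ge_atTop (Real.log K), hCb]
    with x hx hxK hℓ w hw
  rw [Real.log_le_iff_le_exp hK] at hxK
  have hGx : Real.exp (-(C * x ^ 2)) ≤ ‖G x‖ := by
    rw [← he x (by simpa using (by linarith : 0 < x)), Complex.norm_exp, Real.exp_le_exp]
    have := (Complex.abs_re_le_norm (ℓ x)).trans hℓ
    exact (abs_le.1 this).1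
  have hb : ∀ w ∈ Metric.ball (x : ℂ) (x / 2), ‖G w‖ ≤ Real.exp ((5 + C) * x ^ 2) * ‖G x‖ := by
    intro w hw
    obtain ⟨hwre, hwn⟩ := one_lt_re_of_mem_ball hx hw
    calc ‖G w‖ ≤ K * Real.exp (‖w‖ ^ (2 : ℝ)) := hKb w
      _ ≤ Real.exp (x ^ 2) * Real.exp (4 * x ^ 2) := by
          gcongr
          rw [Real.rpow_two]
          nlinarith [norm_nonneg w]
      _ = Real.exp ((5 + C) * x ^ 2) * Real.exp (-(C * x ^ 2)) := by
          rw [← Real.exp_add, ← Real.exp_add]; ring_nf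
      _ ≤ _ := by gcongr
  have := (norm_logDeriv_le_of_ball (w := w) (by linarith) (by positivity)
    hG.1.differentiableOn (fun w hw => by
      have := (one_lt_re_of_mem_ball hx hw).1
      rw [← he w (by linarith)]; exact Complex.exp_ne_zero _) hb (by
      rw [mem_ball_iff_norm] at hw; linarith)).1
  refine this.trans (le_of_eq ?_)
  field_simp
  norm_num

theorem eventually_norm_deriv_stirlingRemainder_le
    (hd : DifferentiableOn ℂ ℓ {z : ℂ | 0 < z.re})
    (he : ∀ z : ℂ, 0 < z.re → Complex.exp (ℓ z) = G z)
    (hG : IsEntireOfOrder G 1)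
    (h : ∀ N k : ℕ, (fun x : ℝ => iteratedDeriv k (stirlingRemainder ℓ a₁ b₁ a₀ b₀ a N) (x : ℂ))
      =O[atTop] fun x : ℝ => x ^ (-((N + 1 + k : ℕ) : ℤ))) (N : ℕ) :
    ∃ C : ℝ, ∀ᶠ x : ℝ in atTop, ∀ w ∈ Metric.ball (x : ℂ) (x / 8),
      ‖deriv (stirlingRemainder ℓ a₁ b₁ a₀ b₀ a N) w‖ ≤ C * x ^ 1 := by
  obtain ⟨C, hC, hCb⟩ := eventually_norm_logDeriv_G_le he hG h
  refine ⟨C + (‖a₁‖ * 3 + ‖b₁‖ + ‖a₀‖ + ∑ n ∈ Finset.Icc 1 N, ‖a n‖ * n), ?_⟩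
  filter_upwards [hCb, eventually_ge_atTop 4] with x hCx hx w hw
  obtain ⟨hwre, hwn⟩ := one_lt_re_of_mem_ball hx
    (Metric.ball_subset_ball (by linarith : x / 8 ≤ x / 2) hw)
  have hw1 : 1 ≤ ‖w‖ := by
    have := (le_abs_self _).trans (Complex.abs_re_le_norm w); linarith
  have hw0 : w ≠ 0 := norm_pos_iff.1 (by linarith)
  have hlog : ‖Complex.log w‖ ≤ 3 * x := by
    refine (Complex.norm_le_abs_re_add_abs_im _).trans ?_
    rw [Complex.log_re, Complex.log_im, abs_of_nonneg (Real.log_nonneg hw1)]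
    have h1 := Real.log_le_sub_one_of_pos (by linarith : 0 < ‖w‖)
    have h2 := Complex.abs_arg_le_pi w
    have h3 := Real.pi_le_four
    linarith
  rw [deriv_stirlingRemainder hd he N (by linarith)]
  have hinv : ‖w⁻¹‖ ≤ 1 := by
    rw [norm_inv]; exact inv_le_one_of_one_le₀ hw1
  have hsum : ‖∑ n ∈ Finset.Icc 1 N, a n * (-(n : ℂ) * w ^ (-(n : ℤ) - 1))‖
      ≤ ∑ n ∈ Finset.Icc 1 N, ‖a n‖ * n := by
    refine (norm_sum_le _ _).trans (Finset.sum_le_sum fun n _ => ?_)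
    rw [norm_mul, norm_mul, norm_neg, Complex.norm_natCast]
    gcongr
    refine mul_le_of_le_one_right (Nat.cast_nonneg _) ?_
    rw [show (-(n : ℤ) - 1) = -((n + 1 : ℕ) : ℤ) by push_cast; ring, zpow_neg, zpow_natCast,
      norm_inv, norm_pow]
    exact inv_le_one_of_one_le₀ (one_le_pow₀ hw1)
  have hx1 : 1 ≤ x := by linarith
  have hS : 0 ≤ ∑ n ∈ Finset.Icc 1 N, ‖a n‖ * n := Finset.sum_nonneg fun _ _ => by positivity
  calc _ ≤ ‖logDeriv G w‖ + (‖a₁ * Complex.log w‖ + ‖b₁‖ + ‖a₀ * w⁻¹‖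
        + ‖∑ n ∈ Finset.Icc 1 N, a n * (-(n : ℂ) * w ^ (-(n : ℤ) - 1))‖) := by
        refine (norm_sub_le _ _).trans ?_
        rw [norm_neg]
        gcongr
        exact norm_add₄_le
    _ ≤ C * x + (‖a₁‖ * (3 * x) + ‖b₁‖ * x + ‖a₀‖ * x
        + (∑ n ∈ Finset.Icc 1 N, ‖a n‖ * n) * x) := by
        rw [norm_mul, norm_mul]
        gcongr
        · exact hCx w hw
        · exact le_mul_of_one_le_right (norm_nonneg _) hx1
        · exact hinv.trans hx1
        · exact hsum.trans (le_mul_of_one_le_right hS hx1)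
    _ = _ := by ring

/-- The twice differentiated Stirling expansion holds along every horizontal line. -/
theorem deriv_logDeriv_G_isBigO (hd : DifferentiableOn ℂ ℓ {z : ℂ | 0 < z.re})
    (he : ∀ z : ℂ, 0 < z.re → Complex.exp (ℓ z) = G z)
    (hG : IsEntireOfOrder G 1)
    (h : ∀ N k : ℕ, (fun x : ℝ => iteratedDeriv k (stirlingRemainder ℓ a₁ b₁ a₀ b₀ a N) (x : ℂ))
      =O[atTop] fun x : ℝ => x ^ (-((N + 1 + k : ℕ) : ℤ))) (x : ℂ) (N : ℕ) :
    (fun y : ℝ => deriv (logDeriv G) (x + y) + (a₁ * (x + y)⁻¹ - a₀ * ((x + y) ^ 2)⁻¹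
        + ∑ n ∈ Finset.Icc 1 N, a n * (n * (n + 1)) * ((x + y) ^ (n + 2))⁻¹))
      =O[atTop] fun y : ℝ => y ^ (-((N + 2 : ℕ) : ℤ)) := by
  obtain ⟨C, hC⟩ := eventually_norm_deriv_stirlingRemainder_le hd he hG h N
  have hdiff : ∀ᶠ x : ℝ in atTop, DifferentiableOn ℂ
      (deriv (stirlingRemainder ℓ a₁ b₁ a₀ b₀ a N)) (Metric.ball (x : ℂ) (x / 8)) := by
    filter_upwards [eventually_ge_atTop 4] with x hx w hw
    have := (one_lt_re_of_mem_ball hx (Metric.ball_subset_ball (by linarith) hw)).1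
    exact (deriv_deriv_stirlingRemainder hd he hG.1 N
      (by linarith)).1.differentiableWithinAt
  have hk : ∀ k : ℕ, (fun x : ℝ =>
      iteratedDeriv k (deriv (stirlingRemainder ℓ a₁ b₁ a₀ b₀ a N)) (x : ℂ))
      =O[atTop] fun x : ℝ => x ^ (-((N + 2 : ℕ) : ℤ)) := by
    intro k
    have h1 := h N (k + 1)
    simp only [iteratedDeriv_succ'] at h1
    refine h1.trans (IsBigO.of_bound 1 ?_)
    filter_upwards [eventually_ge_atTop 1] with x hx
    rw [Real.norm_of_nonneg (by positivity), Real.norm_of_nonneg (by positivity), one_mul]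
    exact zpow_le_zpow_right₀ hx (by push_cast; omega)
  obtain ⟨D, hD⟩ := eventually_norm_le_of_iteratedDeriv_isBigO hdiff hC hk (r := ‖x‖ + 1)
    (by positivity)
  refine IsBigO.of_bound D ?_
  filter_upwards [eventually_norm_deriv_le hdiff hD, eventually_gt_atTop ‖x‖] with y hy hy0
  have hyp : 0 < y := (norm_nonneg x).trans_lt hy0
  rw [Real.norm_of_nonneg (by positivity)]
  have hre : 0 < (x + y).re := by
    have := (abs_le.1 (Complex.abs_re_le_norm x)).1
    simp
    linarith
  have h2 := hy (x + y) (by simp)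
  rw [(deriv_deriv_stirlingRemainder hd he hG.1 N hre).2] at h2
  rw [← norm_neg, neg_add']
  exact h2

end Stirling

/-! ### Simple polar parts -/

theorem HasSimplePolarPart.meromorphicAt {f : ℂ → ℂ} {z r : ℂ} (h : HasSimplePolarPart f z r) :
    MeromorphicAt f z := by
  obtain ⟨g, hg, hf⟩ := h
  have h1 : MeromorphicAt (fun s => r / (s - z) + g s) z := by
    have := hg.meromorphicAt
    fun_prop
  exact h1.congr (hf.mono fun _ hs => hs.symm)

theorem HasSimplePolarPart.meromorphicOrderAt_eq {f : ℂ → ℂ} {z r : ℂ}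
    (h : HasSimplePolarPart f z r) (hr : r ≠ 0) : meromorphicOrderAt f z = -1 := by
  have hm := h.meromorphicAt
  obtain ⟨g, hg, hf⟩ := h
  have : meromorphicOrderAt f z = ((-1 : ℤ) : WithTop ℤ) := by
    rw [meromorphicOrderAt_eq_int_iff hm]
    refine ⟨fun s => r + (s - z) * g s, by fun_prop, by simpa using hr, ?_⟩
    filter_upwards [hf, self_mem_nhdsWithin] with s hs hsz
    have hne : s - z ≠ 0 := sub_ne_zero.2 hsz
    rw [hs, zpow_neg_one, smul_eq_mul]
    field_simp
  exact_mod_cast this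

/-- Reflection `s ↦ 1 - s` changes the sign of a residue. -/
theorem HasSimplePolarPart.comp_one_sub {F : ℂ → ℂ} {z r : ℂ} (h : HasSimplePolarPart F z r) :
    HasSimplePolarPart (fun s => F (1 - s)) (1 - z) (-r) := by
  obtain ⟨g, hg, hF⟩ := h
  have hmap : Tendsto (fun s : ℂ => 1 - s) (𝓝[≠] (1 - z)) (𝓝[≠] z) := by
    refine tendsto_nhdsWithin_iff.2 ⟨tendsto_nhdsWithin_of_tendsto_nhds ?_, ?_⟩
    · have : Continuous fun s : ℂ => 1 - s := by fun_prop
      simpa using this.tendsto (1 - z)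
    · filter_upwards [self_mem_nhdsWithin] with s hs h
      exact hs (by rw [Set.mem_singleton_iff] at h ⊢; linear_combination -h)
  refine ⟨fun s => g (1 - s), ?_, ?_⟩
  · have hg' : AnalyticAt ℂ g (1 - (1 - z)) := by simpa using hg
    exact hg'.comp (f := fun s : ℂ => 1 - s) (by fun_prop)
  · filter_upwards [hmap.eventually hF] with s hs
    rw [hs]
    congr 1
    rw [← neg_div_neg_eq]
    congr 1
    ring

/-! ### Continuation of `𝒥` -/

theorem neg_ofReal_notMem_slitPlane {y : ℝ} (hy : 0 ≤ y) : -(y : ℂ) ∉ Complex.slitPlane := by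
  rintro (h | h)
  · simp at h
    linarith
  · simp at h

theorem isBigO_rpow_of_isBigO_zpow {f : ℝ → ℂ}
    (h : ∀ M : ℕ, f =O[atTop] fun y : ℝ => y ^ (-(M : ℤ))) (a : ℝ) :
    f =O[atTop] fun y : ℝ => y ^ (-a) := by
  obtain ⟨M, hM⟩ := exists_nat_ge a
  refine (h M).trans (IsBigO.of_bound 1 ?_)
  filter_upwards [eventually_ge_atTop 1] with y hy
  rw [Real.norm_of_nonneg (by positivity), Real.norm_of_nonneg (by positivity), one_mul,
    ← Real.rpow_intCast]
  exact Real.rpow_le_rpow_of_exponent_le hy (by push_cast; linarith)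

theorem mellinIntegrand_eq (L : ℂ → ℂ) (s x : ℂ) (y : ℝ) :
    mellinIntegrand L s x y = (y : ℂ) ^ (1 - s - 1) • logDeriv L (x + y) := by
  rw [mellinIntegrand, show 1 - s - 1 = -s by ring, smul_eq_mul, mul_comm]

namespace IsPrimaryFunction

variable {L G Ξ : ℂ → ℂ} {q : ℕ} (hL : IsPrimaryFunction L G Ξ q) {x : ℂ}
  (hx1 : x - 1 ∈ Complex.slitPlane) (hxL : ∀ z : ℂ, L z = 0 → x - z ∈ Complex.slitPlane)

include hL hx1 hxL

theorem analyticAt_logDeriv_L_add {y : ℝ} (hy : 0 ≤ y) : AnalyticAt ℂ (logDeriv L) (x + y) := by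
  have h1 : x + (y : ℂ) ≠ 1 := fun h => neg_ofReal_notMem_slitPlane hy (by
    rwa [show x - 1 = -(y : ℂ) by linear_combination h] at hx1)
  have h2 : L (x + y) ≠ 0 := fun h => neg_ofReal_notMem_slitPlane hy (by
    have := hxL _ h
    rwa [show x - (x + y) = -(y : ℂ) by ring] at this)
  have h3 := hL.analyticAt _ h1
  exact h3.deriv.div h3 h2

theorem locallyIntegrableOn_logDeriv_L_add :
    MeasureTheory.LocallyIntegrableOn (fun y : ℝ => logDeriv L (x + y)) (Set.Ioi 0) := by
  refine ContinuousOn.locallyIntegrableOn (fun y hy => ?_) measurableSet_Ioi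
  have h1 := (hL.analyticAt_logDeriv_L_add hx1 hxL (le_of_lt hy)).continuousAt
  have h2 : ContinuousAt (fun y : ℝ => x + (y : ℂ)) y := by fun_prop
  exact (ContinuousAt.comp (f := fun y : ℝ => x + (y : ℂ)) h1 h2).continuousWithinAt

theorem taylor_logDeriv_L_add (N : ℕ) :
    (fun t : ℝ => logDeriv L (x + t) - ∑ k ∈ Finset.range N,
      iteratedDeriv k (logDeriv L) x / k.factorial * (t : ℂ) ^ k) =O[𝓝[>] 0] fun t : ℝ => t ^ N := by
  have h := hL.analyticAt_logDeriv_L_add hx1 hxL le_rfl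
  rw [Complex.ofReal_zero, add_zero] at h
  exact h.isBigO_taylor_ofReal N

theorem integrableOn_mellinIntegrand {s : ℂ} (hs : s.re < 1) :
    MeasureTheory.IntegrableOn (mellinIntegrand L s x) (Set.Ioi 0) := by
  have h0 := hL.taylor_logDeriv_L_add hx1 hxL 0
  have h : MellinConvergent (fun y : ℝ => logDeriv L (x + y)) (1 - s) :=
    mellinConvergent_of_isBigO_rpow (a := (1 - s).re + 1) (b := 0)
      (hL.locallyIntegrableOn_logDeriv_L_add hx1 hxL)
      (isBigO_rpow_of_isBigO_zpow (hL.logDeriv_L_isBigO x) _) (by linarith)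
      (by simpa using h0) (by simpa using hs)
  exact MeasureTheory.IntegrableOn.congr_fun h (fun y _ => (mellinIntegrand_eq L s x y).symm)
    measurableSet_Ioi

/-- The meromorphic continuation of `𝒥`. -/
theorem exists_continuation_mellinJ :
    ∃ J : ℂ → ℂ,
      MeromorphicOn J Set.univ ∧
      (∀ s : ℂ, s.re < 1 → J s = mellinJ L s x) ∧
      (∀ s : ℂ, (∀ n : ℕ, 1 ≤ n → s ≠ (n : ℂ)) → AnalyticAt ℂ J s) ∧
      (∀ n : ℕ, 1 ≤ n →
        HasSimplePolarPart J (n : ℂ) (-logDerivN L n x / ((n - 1).factorial : ℂ))) ∧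
      (∀ n : ℕ, 1 ≤ n → logDerivN L n x ≠ 0 → meromorphicOrderAt J (n : ℂ) = -1) := by
  obtain ⟨F, hF⟩ := exists_mellin_continuation
    (hL.locallyIntegrableOn_logDeriv_L_add hx1 hxL) (hL.taylor_logDeriv_L_add hx1 hxL)
  replace hF := fun a => hF a (isBigO_rpow_of_isBigO_zpow (hL.logDeriv_L_isBigO x) a)
  have han : ∀ s : ℂ, (∀ n : ℕ, 1 ≤ n → s ≠ (n : ℂ)) → AnalyticAt ℂ (fun s => F (1 - s)) s := by
    intro s hs
    refine AnalyticAt.comp (f := fun s : ℂ => 1 - s)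
      ((hF ((1 - s).re + 1)).2.1 _ (by linarith) fun k hk => hs (k + 1) (by omega) ?_)
      (by fun_prop)
    push_cast
    linear_combination -hk
  have hpol : ∀ n : ℕ, 1 ≤ n → HasSimplePolarPart (fun s => F (1 - s)) (n : ℂ)
      (-logDerivN L n x / ((n - 1).factorial : ℂ)) := by
    intro n hn
    obtain ⟨k, rfl⟩ : ∃ k, n = k + 1 := ⟨n - 1, by omega⟩
    have h := ((hF 1).2.2 k (by
      have : (0 : ℝ) ≤ k := Nat.cast_nonneg k
      linarith)).comp_one_sub
    have e1 : (1 : ℂ) - -(k : ℂ) = ((k + 1 : ℕ) : ℂ) := by push_cast; ring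
    rw [e1, ← neg_div] at h
    exact h
  refine ⟨fun s => F (1 - s), fun s _ => ?_, fun s hs => ?_, han, hpol, fun n hn h0 => ?_⟩
  · by_cases h : ∃ n : ℕ, 1 ≤ n ∧ s = n
    · obtain ⟨n, hn, rfl⟩ := h
      exact (hpol n hn).meromorphicAt
    · push Not at h
      exact (han s h).meromorphicAt
  · show F (1 - s) = _
    rw [(hF ((1 - s).re + 1)).1 (1 - s) (by simpa using hs) (by linarith), mellin, mellinJ]
    simp_rw [mellinIntegrand_eq]
  · refine (hpol n hn).meromorphicOrderAt_eq ?_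
    exact div_ne_zero (neg_ne_zero.2 h0) (by exact_mod_cast Nat.factorial_ne_zero _)

end IsPrimaryFunction

/-! ### Real values -/

/-- Complex derivatives of a holomorphic function which is real on `(1, ∞)` are given there by the
derivatives of its restriction to the real axis. -/
theorem iteratedDeriv_ofReal_eq {F : ℂ → ℂ} {g : ℝ → ℝ}
    (hF : ∀ t : ℝ, 1 < t → AnalyticAt ℂ F t) (hFg : ∀ t : ℝ, 1 < t → F t = g t) (k : ℕ) :
    ∀ t : ℝ, 1 < t → iteratedDeriv k F t = ((iteratedDeriv k g t : ℝ) : ℂ) := by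
  induction k with
  | zero => simpa using hFg
  | succ k ih =>
    intro t ht
    have han : AnalyticAt ℂ (iteratedDeriv k F) t := by
      rw [iteratedDeriv_eq_iterate]
      exact (hF t ht).iterated_deriv k
    have h1 := han.differentiableAt.hasDerivAt.comp_ofReal
    have h2 : HasDerivAt (fun u : ℝ => ((iteratedDeriv k g u : ℝ) : ℂ))
        (deriv (iteratedDeriv k F) t) t :=
      h1.congr_of_eventuallyEq (by
        filter_upwards [lt_mem_nhds ht] with u hu using (ih u hu).symm)
    have h3 : HasDerivAt (iteratedDeriv k g) (deriv (iteratedDeriv k F) t).re t := by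
      have := Complex.reCLM.hasFDerivAt.comp_hasDerivAt t h2
      simpa [Function.comp_def] using this
    rw [iteratedDeriv_succ, iteratedDeriv_succ, h3.deriv]
    exact h2.unique h3.ofReal_comp

theorem IsPrimaryFunction.logDerivN_ofReal {L G Ξ : ℂ → ℂ} {q : ℕ}
    (hL : IsPrimaryFunction L G Ξ q) (hreal : ∀ t : ℝ, 1 < t → (L (t : ℂ)).im = 0) {n : ℕ}
    (hn : 1 ≤ n) {t : ℝ} (ht : 1 < t) :
    logDerivN L n (t : ℂ)
      = ((iteratedDeriv n (fun u : ℝ => Real.log ‖L (u : ℂ)‖) t : ℝ) : ℂ) := by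
  obtain ⟨k, rfl⟩ : ∃ k, n = k + 1 := ⟨n - 1, by omega⟩
  have hre : ∀ u : ℝ, 1 < u → L u = ((L u).re : ℂ) := fun u hu =>
    Complex.ext (by simp) (by simpa using hreal u hu)
  have hLan : ∀ u : ℝ, 1 < u → AnalyticAt ℂ L u := fun u hu =>
    hL.analyticAt _ (ne_one_of_one_lt_re (by simpa using hu))
  have hL0 : ∀ u : ℝ, 1 < u → L u ≠ 0 := fun u hu => hL.ne_zero _ (by simpa using hu)
  rw [logDerivN, iteratedDeriv_succ', Nat.add_sub_cancel]
  refine iteratedDeriv_ofReal_eq (fun u hu => (hLan u hu).deriv.div (hLan u hu) (hL0 u hu))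
    (fun u hu => ?_) k t ht
  have h1 := (hLan u hu).differentiableAt.hasDerivAt.comp_ofReal
  have h2 : HasDerivAt (fun u : ℝ => (L u).re) (deriv L u).re u := by
    have := Complex.reCLM.hasFDerivAt.comp_hasDerivAt u h1
    simpa [Function.comp_def] using this
  have h3 : HasDerivAt (fun u : ℝ => (((L u).re : ℝ) : ℂ)) (deriv L u) u :=
    h1.congr_of_eventuallyEq (by
      filter_upwards [lt_mem_nhds hu] with v hv using (hre v hv).symm)
  have h4 : deriv L u = ((deriv L u).re : ℂ) := h3.unique h2.ofReal_comp
  have hne : (L u).re ≠ 0 := fun h => hL0 u hu (by rw [hre u hu, h, Complex.ofReal_zero])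
  have h5 : HasDerivAt (fun u : ℝ => Real.log ‖L u‖) ((deriv L u).re / (L u).re) u := by
    refine (h2.log hne).congr_of_eventuallyEq ?_
    filter_upwards [lt_mem_nhds hu] with v hv
    rw [hre v hv, Complex.norm_real, Real.norm_eq_abs, Real.log_abs, Complex.ofReal_re]
  rw [h5.deriv, Pi.div_apply, h4, hre u hu]
  push_cast
  simp

/-! ### The zeta function over the zeros in its half-plane of convergence -/

theorem norm_zeroZetaTerm_le {Ξ : ℂ → ℂ} {s x : ℂ} (ρ : {ρ : ℂ // Ξ ρ = 0})
    (hρ : x - (ρ : ℂ) ≠ 0) :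
    ‖zeroZetaTerm Ξ s x ρ‖ ≤ Real.exp (Real.pi * |s.im|) *
      ((analyticOrderNatAt Ξ (ρ : ℂ) : ℝ) * ‖x - (ρ : ℂ)‖ ^ (-s.re)) := by
  rw [zeroZetaTerm, norm_mul, Complex.norm_natCast, Complex.norm_cpow_of_ne_zero hρ,
    Complex.neg_re, Complex.neg_im, div_eq_mul_inv, ← Real.exp_neg]
  have h : -(Complex.arg (x - ρ) * -s.im) ≤ Real.pi * |s.im| := by
    calc -(Complex.arg (x - ρ) * -s.im) ≤ |-(Complex.arg (x - ρ) * -s.im)| := le_abs_self _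
      _ = |Complex.arg (x - ρ)| * |s.im| := by rw [abs_neg, abs_mul, abs_neg]
      _ ≤ _ := by gcongr; exact Complex.abs_arg_le_pi _
  calc _ ≤ (analyticOrderNatAt Ξ (ρ : ℂ) : ℝ) *
        (‖x - (ρ : ℂ)‖ ^ (-s.re) * Real.exp (Real.pi * |s.im|)) := by gcongr
    _ = _ := by ring

section ZeroZeta

variable {Ξ : ℂ → ℂ} (hΞ : Differentiable ℂ Ξ) (h0 : Ξ 0 ≠ 0)
  (hb : ∀ a : ℝ, 1 < a → ∃ K : ℝ, 0 < K ∧ ∀ z : ℂ, ‖Ξ z‖ ≤ K * Real.exp (‖z‖ ^ a))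
  {x : ℂ} (hx : ∀ ρ : ℂ, Ξ ρ = 0 → x - ρ ∈ Complex.slitPlane)

include hΞ h0 hb hx

theorem summable_zeroZetaTerm {s : ℂ} (hs : 1 < s.re) : Summable (zeroZetaTerm Ξ s x) :=
  Summable.of_norm_bounded ((summable_zeros_sub_rpow hΞ h0 hb x hs).mul_left _) fun ρ =>
    norm_zeroZetaTerm_le ρ (Complex.slitPlane_ne_zero (hx _ ρ.2))

theorem analyticAt_zeroZeta {s : ℂ} (hs : 1 < s.re) :
    AnalyticAt ℂ (fun s => zeroZeta Ξ s x) s := by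
  obtain ⟨σ, hσ1, hσs⟩ := exists_between hs
  set U : Set ℂ := {z : ℂ | σ < z.re} ∩ ({z : ℂ | z.re < s.re + 1} ∩ {z : ℂ | |z.im| < |s.im| + 1})
    with hU
  have hUo : IsOpen U := (isOpen_lt continuous_const Complex.continuous_re).inter
    ((isOpen_lt Complex.continuous_re continuous_const).inter
      (isOpen_lt Complex.continuous_im.abs continuous_const))
  have hsU : s ∈ U := ⟨hσs, by simp, by simp⟩
  refine DifferentiableOn.analyticAt (s := U) ?_ (hUo.mem_nhds hsU)
  refine Complex.differentiableOn_tsum_of_summable_norm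
    (u := fun ρ => Real.exp (Real.pi * (|s.im| + 1)) *
      ((analyticOrderNatAt Ξ (ρ : ℂ) : ℝ) * ‖x - (ρ : ℂ)‖ ^ (-σ) +
        (analyticOrderNatAt Ξ (ρ : ℂ) : ℝ) * ‖x - (ρ : ℂ)‖ ^ (-(s.re + 1))))
    (((summable_zeros_sub_rpow hΞ h0 hb x hσ1).add
      (summable_zeros_sub_rpow hΞ h0 hb x (by linarith))).mul_left _) (fun ρ => ?_) hUo
    fun ρ z hz => ?_
  · have hne := Complex.slitPlane_ne_zero (hx _ ρ.2)
    intro z _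
    have : DifferentiableAt ℂ (fun z : ℂ => (x - (ρ : ℂ)) ^ (-z)) z :=
      (differentiableAt_id.neg).const_cpow (Or.inl hne)
    exact (this.const_mul _).differentiableWithinAt
  · have hne : 0 < ‖x - (ρ : ℂ)‖ := norm_pos_iff.2 (Complex.slitPlane_ne_zero (hx _ ρ.2))
    have h1 : σ < z.re := hz.1
    have h2 : z.re < s.re + 1 := hz.2.1
    have h3 : |z.im| < |s.im| + 1 := hz.2.2
    refine (norm_zeroZetaTerm_le ρ (norm_pos_iff.1 hne)).trans ?_
    rw [← mul_add]
    gcongr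
    rcases le_total 1 ‖x - (ρ : ℂ)‖ with h | h
    · exact (Real.rpow_le_rpow_of_exponent_le h (by linarith)).trans
        (le_add_of_nonneg_right (by positivity))
    · exact (Real.rpow_le_rpow_of_exponent_ge hne h (by linarith)).trans
        (le_add_of_nonneg_left (by positivity))

omit hb in
/-- The distance of the points `x - ρ + y` from the origin is comparable with `‖x - ρ‖ + y`,
uniformly in the zero `ρ`: the zeros lie in a vertical strip, so that far away the direction of
`x - ρ` is nearly vertical. -/
theorem exists_pos_mul_le_norm_sub_zero_add (hre : ∀ ρ : ℂ, Ξ ρ = 0 → ρ.re < 1) :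
    ∃ c : ℝ, 0 < c ∧ ∀ ρ : {ρ : ℂ // Ξ ρ = 0}, ∀ y : ℝ, 0 ≤ y →
      c * (‖x - (ρ : ℂ)‖ + y) ≤ ‖x - (ρ : ℂ) + y‖ := by
  classical
  have hfar : ∀ᶠ ρ : {ρ : ℂ // Ξ ρ = 0} in cofinite, ∀ y : ℝ, 0 ≤ y →
      1 / 2 * (‖x - (ρ : ℂ)‖ + y) ≤ ‖x - (ρ : ℂ) + y‖ := by
    filter_upwards [(tendsto_norm_zeros_cofinite hΞ h0).eventually_ge_atTop (3 * ‖x‖ + 2)]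
      with ρ hρ y hy
    have h1 : ‖(ρ : ℂ)‖ - ‖x‖ ≤ ‖x - (ρ : ℂ)‖ := by
      rw [norm_sub_rev]; exact norm_sub_norm_le _ _
    have h2 := (abs_le.1 (Complex.abs_re_le_norm x)).1
    have h3 := hre _ ρ.2
    have h4 := sqrt_mul_le_norm_add (w := x - (ρ : ℂ)) (κ := 1 / 2) (y := y) (by norm_num)
      (by norm_num) (by rw [Complex.sub_re]; linarith) hy
    rwa [show ((1 : ℝ) - 1 / 2) / 2 = (1 / 2) ^ 2 by norm_num, Real.sqrt_sq (by norm_num)] at h4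
  choose c hc0 hc using fun ρ : {ρ : ℂ // Ξ ρ = 0} => exists_pos_mul_le_norm_add (hx _ ρ.2)
  obtain ⟨S, hS⟩ : ∃ S : Finset {ρ : ℂ // Ξ ρ = 0}, ∀ ρ ∉ S, ∀ y : ℝ, 0 ≤ y →
      1 / 2 * (‖x - (ρ : ℂ)‖ + y) ≤ ‖x - (ρ : ℂ) + y‖ := by
    rw [eventually_cofinite] at hfar
    refine ⟨hfar.toFinset, fun ρ hρ => ?_⟩
    by_contra h
    exact hρ (hfar.mem_toFinset.2 h)
  obtain ⟨δ, hδ0, hδ⟩ : ∃ δ : ℝ, 0 < δ ∧ ∀ ρ ∈ S, δ ≤ c ρ := by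
    obtain ⟨M, hM⟩ := Finset.exists_le (S.image fun ρ => (c ρ)⁻¹)
    exact ⟨(max M 1)⁻¹, by positivity, fun ρ hρ => inv_le_of_inv_le₀ (hc0 ρ)
      ((hM _ (Finset.mem_image_of_mem _ hρ)).trans (le_max_left _ _))⟩
  refine ⟨min (1 / 2) δ, lt_min (by norm_num) hδ0, fun ρ y hy => ?_⟩
  by_cases hρ : ρ ∈ S
  · refine le_trans ?_ (hc ρ y hy)
    gcongr
    exact (min_le_right _ _).trans (hδ ρ hρ)
  · refine le_trans ?_ (hS ρ hρ y hy)
    gcongr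
    exact min_le_left _ _

omit hΞ h0 hb hx in
theorem integral_rpow_div_add_sq {r σ : ℝ} (hr : 0 < r) (hσ : 0 < σ) (hσ2 : σ < 2) :
    ∫ y in Set.Ioi (0 : ℝ), y ^ (σ - 1) * ((r + y) ^ 2)⁻¹
      = r ^ (σ - 2) * ‖Complex.Gamma σ * Complex.Gamma (2 - σ)‖ := by
  have h := mellin_inv_add_sq_ofReal hr (z := (σ : ℂ)) (by simpa using hσ) (by simpa using hσ2)
  have h1 : mellin (fun y : ℝ => (((r : ℂ) + y) ^ 2)⁻¹) (σ : ℂ)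
      = ((∫ y in Set.Ioi (0 : ℝ), y ^ (σ - 1) * ((r + y) ^ 2)⁻¹ : ℝ) : ℂ) := by
    rw [mellin, ← integral_complex_ofReal]
    refine MeasureTheory.setIntegral_congr_fun measurableSet_Ioi fun y hy => ?_
    have hy' : (0 : ℝ) < y := hy
    simp only [smul_eq_mul]
    push_cast
    rw [Complex.ofReal_cpow hy'.le]
    push_cast
    rfl
  have h2 : 0 ≤ ∫ y in Set.Ioi (0 : ℝ), y ^ (σ - 1) * ((r + y) ^ 2)⁻¹ := by
    refine MeasureTheory.setIntegral_nonneg measurableSet_Ioi fun y hy => ?_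
    have hy' : (0 : ℝ) < y := hy
    positivity
  rw [h1] at h
  have h3 := congrArg norm h
  rw [Complex.norm_of_nonneg h2, norm_mul, Complex.norm_cpow_eq_rpow_re_of_pos hr] at h3
  simpa using h3

/-- For `1 < Re s < 2`, the zeta function over the zeros is a Mellin transform of the second
logarithmic derivative. -/
theorem mellin_deriv_logDeriv_eq (hre : ∀ ρ : ℂ, Ξ ρ = 0 → ρ.re < 1) {s : ℂ} (hs : 1 < s.re)
    (hs2 : s.re < 2) :
    mellin (fun y : ℝ => -deriv (logDeriv Ξ) (x + y)) (2 - s)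
      = zeroZeta Ξ s x * (Complex.Gamma (2 - s) * Complex.Gamma s) := by
  obtain ⟨c, hc, hcρ⟩ := exists_pos_mul_le_norm_sub_zero_add hΞ h0 hx hre
  set z : ℂ := 2 - s with hz
  have hzre : z.re = 2 - s.re := by simp [hz]
  have hz0 : 0 < z.re := by linarith
  have hz2 : z.re < 2 := by linarith
  set m : {ρ : ℂ // Ξ ρ = 0} → ℂ := fun ρ => (analyticOrderNatAt Ξ (ρ : ℂ) : ℂ) with hm
  set Φ : {ρ : ℂ // Ξ ρ = 0} → ℝ → ℂ := fun ρ y =>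
    m ρ * ((y : ℂ) ^ (z - 1) • ((x - (ρ : ℂ) + y) ^ 2)⁻¹) with hΦ
  have hconv : ∀ ρ : {ρ : ℂ // Ξ ρ = 0},
      MellinConvergent (fun y : ℝ => ((x - (ρ : ℂ) + y) ^ 2)⁻¹) z :=
    fun ρ => mellinConvergent_inv_add_sq (hx _ ρ.2) hz0 hz2
  have hint : ∀ ρ, MeasureTheory.Integrable (Φ ρ)
      (MeasureTheory.volume.restrict (Set.Ioi 0)) := fun ρ => (hconv ρ).const_mul (m ρ)
  have hsum : Summable fun ρ => ∫ y in Set.Ioi (0 : ℝ), ‖Φ ρ y‖ := by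
    refine Summable.of_nonneg_of_le
      (fun ρ => MeasureTheory.integral_nonneg fun y => norm_nonneg _) (fun ρ => ?_)
      ((summable_zeros_sub_rpow hΞ h0 hb x hs).mul_left
        ((c ^ 2)⁻¹ * ‖Complex.Gamma (z.re : ℝ) * Complex.Gamma (2 - (z.re : ℝ))‖))
    have hw0 := Complex.slitPlane_ne_zero (hx _ ρ.2)
    have hw : 0 < ‖x - (ρ : ℂ)‖ := norm_pos_iff.2 hw0
    calc ∫ y in Set.Ioi (0 : ℝ), ‖Φ ρ y‖
        ≤ ∫ y in Set.Ioi (0 : ℝ), ‖m ρ‖ * ((c ^ 2)⁻¹ *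
            (y ^ (z.re - 1) * ((‖x - (ρ : ℂ)‖ + y) ^ 2)⁻¹)) := by
          refine MeasureTheory.setIntegral_mono_on (hint ρ).norm
            (((integrableOn_rpow_div_add_sq hw hz0 hz2).const_mul _).const_mul _)
            measurableSet_Ioi fun y hy => ?_
          have hy' : (0 : ℝ) < y := hy
          rw [hΦ, norm_mul]
          gcongr
          exact norm_cpow_smul_inv_add_sq_le hc hw0 hy' (hcρ ρ y hy'.le) z
      _ = _ := by
          rw [MeasureTheory.integral_const_mul, MeasureTheory.integral_const_mul,
            integral_rpow_div_add_sq hw hz0 hz2, hm, Complex.norm_natCast, hzre,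
            show 2 - s.re - 2 = -s.re by ring]
          ring
  have hcount : Countable {ρ : ℂ // Ξ ρ = 0} := by
    rw [← Set.countable_univ_iff]
    refine (Set.countable_iUnion fun n : ℕ => (finite_zeros_norm_le hΞ h0 n).countable).mono ?_
    intro ρ _
    obtain ⟨n, hn⟩ := exists_nat_ge ‖(ρ : ℂ)‖
    exact Set.mem_iUnion.2 ⟨n, hn⟩
  have hfub := MeasureTheory.hasSum_integral_of_summable_integral_norm hint hsum
  have hval : ∀ ρ : {ρ : ℂ // Ξ ρ = 0}, ∫ y in Set.Ioi (0 : ℝ), Φ ρ y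
      = zeroZetaTerm Ξ s x ρ * (Complex.Gamma (2 - s) * Complex.Gamma s) := by
    intro ρ
    have h1 := mellin_inv_add_sq (hx _ ρ.2) hz0 hz2
    rw [mellin] at h1
    rw [hΦ, MeasureTheory.integral_const_mul, h1, zeroZetaTerm, hz,
      show 2 - s - 2 = -s by ring, show 2 - (2 - s) = s by ring]
    ring
  simp_rw [hval] at hfub
  have h2 := (summable_zeroZetaTerm hΞ h0 hb hx hs).hasSum.mul_right
    (Complex.Gamma (2 - s) * Complex.Gamma s)
  rw [zeroZeta, h2.unique hfub, mellin]
  refine MeasureTheory.setIntegral_congr_fun measurableSet_Ioi fun y hy => ?_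
  have hy' : (0 : ℝ) < y := hy
  have hΞy : Ξ (x + y) ≠ 0 := fun h => neg_ofReal_notMem_slitPlane hy'.le (by
    have := hx _ h
    rwa [show x - (x + y) = -(y : ℂ) by ring] at this)
  have h3 := (hasSum_zeros_inv_sq hΞ h0 hb hΞy).mul_left ((y : ℂ) ^ (z - 1))
  simp only [smul_eq_mul]
  rw [← h3.tsum_eq]
  refine tsum_congr fun ρ => ?_
  rw [hΦ, hm]
  simp only [smul_eq_mul]
  rw [show x + (y : ℂ) - ρ = x - ρ + y by ring]
  ring

end ZeroZeta

/-! ### Continuation of `𝒵` -/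

/-- Multiplication by `u` multiplies the residue by `u z`; in particular a zero of `u` cancels the
pole. -/
theorem HasSimplePolarPart.mul_analyticAt {F u : ℂ → ℂ} {z r : ℂ} (h : HasSimplePolarPart F z r)
    (hu : AnalyticAt ℂ u z) : HasSimplePolarPart (fun s => F s * u s) z (r * u z) := by
  obtain ⟨g, hg, hF⟩ := h
  refine ⟨fun s => r * dslope u z s + g s * u s, ?_, ?_⟩
  · have hd : AnalyticAt ℂ (dslope u z) z := by
      obtain ⟨p, hp⟩ := hu
      exact hp.has_fpower_series_dslope_fslope.analyticAt
    exact (analyticAt_const.mul hd).add (hg.mul hu)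
  · filter_upwards [hF, self_mem_nhdsWithin] with s hs hsz
    have hne : s - z ≠ 0 := sub_ne_zero.2 hsz
    rw [hs, dslope_of_ne _ hsz, slope_def_field]
    field_simp
    ring

theorem HasSimplePolarPart.comp_sub_const {F : ℂ → ℂ} {z r : ℂ} (h : HasSimplePolarPart F z r)
    (c : ℂ) : HasSimplePolarPart (fun s => F (s - c)) (z + c) r := by
  obtain ⟨g, hg, hF⟩ := h
  have hmap : Tendsto (fun s : ℂ => s - c) (𝓝[≠] (z + c)) (𝓝[≠] z) := by
    refine tendsto_nhdsWithin_iff.2 ⟨tendsto_nhdsWithin_of_tendsto_nhds ?_, ?_⟩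
    · have : Continuous fun s : ℂ => s - c := by fun_prop
      simpa using this.tendsto (z + c)
    · filter_upwards [self_mem_nhdsWithin] with s hs h
      exact hs (by rw [Set.mem_singleton_iff] at h ⊢; linear_combination h)
  refine ⟨fun s => g (s - c), ?_, ?_⟩
  · have hg' : AnalyticAt ℂ g (z + c - c) := by simpa using hg
    exact hg'.comp (f := fun s : ℂ => s - c) (by fun_prop)
  · filter_upwards [hmap.eventually hF] with s hs
    rw [hs]
    congr 2
    ring

theorem HasSimplePolarPart.congr {f g : ℂ → ℂ} {z r : ℂ} (h : HasSimplePolarPart f z r)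
    (hfg : f =ᶠ[𝓝[≠] z] g) : HasSimplePolarPart g z r := by
  obtain ⟨k, hk, hf⟩ := h
  exact ⟨k, hk, by filter_upwards [hf, hfg] with s hs hs' using hs' ▸ hs⟩

/-- Removal of singularities: if every singularity of `f` is a simple polar part, `f` can be
redefined on its singular set so as to be holomorphic where the residue vanishes. -/
theorem exists_meromorphic_of_hasSimplePolarPart {f : ℂ → ℂ} {z₀ r₀ : ℂ}
    (h0 : HasSimplePolarPart f z₀ r₀)
    (h : ∀ s : ℂ, s ≠ z₀ → AnalyticAt ℂ f s ∨ HasSimplePolarPart f s 0) :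
    ∃ Z : ℂ → ℂ, MeromorphicOn Z Set.univ ∧ (∀ s : ℂ, AnalyticAt ℂ f s → Z s = f s) ∧
      (∀ s : ℂ, s ≠ z₀ → AnalyticAt ℂ Z s) ∧ HasSimplePolarPart Z z₀ r₀ := by
  have hm : MeromorphicOn f Set.univ := by
    intro s _
    rcases eq_or_ne s z₀ with rfl | hs
    · exact h0.meromorphicAt
    · rcases h s hs with h | h
      · exact h.meromorphicAt
      · exact h.meromorphicAt
  have hNF := meromorphicNFOn_toMeromorphicNFOn f Set.univ
  refine ⟨toMeromorphicNFOn f Set.univ, hNF.meromorphicOn, fun s hs => ?_, fun s hs => ?_,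
    h0.congr (hm.toMeromorphicNFOn_eq_self_on_nhdsNE (Set.mem_univ _)).symm⟩
  · rw [toMeromorphicNFOn_eq_toMeromorphicNFAt hm (Set.mem_univ s),
      toMeromorphicNFAt_eq_self.2 hs.meromorphicNFAt]
  · rw [← (hNF (Set.mem_univ s)).meromorphicOrderAt_nonneg_iff_analyticAt,
      meromorphicOrderAt_toMeromorphicNFOn hm (Set.mem_univ s)]
    rcases h s hs with h | ⟨g, hg, hfg⟩
    · exact h.meromorphicOrderAt_nonneg
    · rw [meromorphicOrderAt_congr (f₂ := g) (by
        filter_upwards [hfg] with w hw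
        simpa using hw)]
      exact hg.meromorphicOrderAt_nonneg

namespace IsPrimaryFunction

variable {L G Ξ : ℂ → ℂ} {q : ℕ}

/-- The functional relation `G Ξ = (z - 1)^q L` in terms of second logarithmic derivatives. -/
theorem neg_deriv_logDeriv_Xi (hL : IsPrimaryFunction L G Ξ q) {z : ℂ} (hz : 1 < z.re) :
    -deriv (logDeriv Ξ) z
      = deriv (logDeriv G) z - deriv (logDeriv L) z + q * ((z - 1) ^ 2)⁻¹ := by
  have ho : {w : ℂ | 1 < w.re} ∈ 𝓝 z :=
    (isOpen_lt continuous_const Complex.continuous_re).mem_nhds hz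
  have hne : ∀ w : ℂ, 1 < w.re → w - 1 ≠ 0 := fun w hw => sub_ne_zero.2 (ne_one_of_one_lt_re hw)
  have hGΞ : ∀ w : ℂ, 1 < w.re → G w ≠ 0 ∧ Ξ w ≠ 0 := fun w hw => by
    rw [← mul_ne_zero_iff, hL.factor w (ne_one_of_one_lt_re hw)]
    exact mul_ne_zero (pow_ne_zero _ (hne w hw)) (hL.ne_zero w hw)
  have hLan : ∀ w : ℂ, 1 < w.re → AnalyticAt ℂ L w := fun w hw =>
    hL.analyticAt w (ne_one_of_one_lt_re hw)
  have hlog : logDeriv Ξ =ᶠ[𝓝 z] fun w => q * (w - 1)⁻¹ + logDeriv L w - logDeriv G w := by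
    filter_upwards [ho] with w hw
    have hw' : 1 < w.re := hw
    have h1 := logDeriv_mul w (hGΞ w hw').1 (hGΞ w hw').2 (hL.order_G.1 w) (hL.order_Xi.1 w)
    have h2 : (fun w => G w * Ξ w) =ᶠ[𝓝 w] fun w => (w - 1) ^ q * L w := by
      filter_upwards [isOpen_ne.mem_nhds (ne_one_of_one_lt_re hw')] with u hu using hL.factor u hu
    rw [(logDeriv_congr_nhds h2).eq_of_nhds, logDeriv_mul (f := fun w => (w - 1) ^ q) w (pow_ne_zero _ (hne w hw'))
      (hL.ne_zero w hw') (by fun_prop) (hLan w hw').differentiableAt,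
      logDeriv_fun_pow (by fun_prop)] at h1
    have h3 : logDeriv (fun w : ℂ => w - 1) w = (w - 1)⁻¹ := by
      rw [logDeriv_apply]; simp
    rw [h3] at h1
    rw [h1]
    ring
  have hdL : DifferentiableAt ℂ (logDeriv L) z :=
    ((hLan z hz).deriv.div (hLan z hz) (hL.ne_zero z hz)).differentiableAt
  have hdG : DifferentiableAt ℂ (logDeriv G) z :=
    ((hL.order_G.1.analyticAt z).deriv.div (hL.order_G.1.analyticAt z)
      (hGΞ z hz).1).differentiableAt
  have hinv := ((((hasDerivAt_id z).sub_const 1).inv (hne z hz)).const_mul (q : ℂ))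
  have h4 := (hinv.add hdL.hasDerivAt).sub hdG.hasDerivAt
  rw [hlog.deriv_eq]
  refine (congrArg Neg.neg h4.deriv).trans ?_
  simp only [id]
  ring

variable {a₁ b₁ a₀ b₀ : ℂ} {a : ℕ → ℂ}

/-- The analytic function of `t` which approximates `-t⁻¹ (Ξ'/Ξ)'(x + 1/t)` up to `O(t ^ (N + 1))`:
the Stirling expansion and the contribution of the factor `(z - 1) ^ q`, rewritten in terms of
`1 / (x + 1/t) = t / (1 + x t)`. -/
noncomputable def inverseExpansion (q : ℕ) (a₁ a₀ : ℂ) (a : ℕ → ℂ) (x : ℂ) (N : ℕ) (t : ℂ) : ℂ :=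
  q * (t * ((1 + (x - 1) * t)⁻¹) ^ 2) - a₁ * (1 + x * t)⁻¹ + a₀ * (t * ((1 + x * t)⁻¹) ^ 2)
    - ∑ n ∈ Finset.Icc 1 N, a n * (n * (n + 1)) * (t ^ (n + 1) * ((1 + x * t)⁻¹) ^ (n + 2))

theorem analyticAt_inverseExpansion (x : ℂ) (N : ℕ) :
    AnalyticAt ℂ (inverseExpansion q a₁ a₀ a x N) 0 := by
  have h1 : ∀ u : ℂ, AnalyticAt ℂ (fun t : ℂ => (1 + u * t)⁻¹) 0 := fun u =>
    AnalyticAt.inv (by fun_prop) (by simp)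
  have h2 := h1 x
  have h3 := h1 (x - 1)
  unfold inverseExpansion
  refine AnalyticAt.sub (by fun_prop) (Finset.analyticAt_fun_sum _ fun n _ => by fun_prop)

theorem inverseExpansion_zero (x : ℂ) (N : ℕ) : inverseExpansion q a₁ a₀ a x N 0 = -a₁ := by
  simp [inverseExpansion]

theorem inverseExpansion_eq {x t : ℂ} (ht : t ≠ 0) (h1 : 1 + x * t ≠ 0)
    (h2 : 1 + (x - 1) * t ≠ 0) (N : ℕ) :
    inverseExpansion q a₁ a₀ a x N t = t⁻¹ * (-(a₁ * (x + t⁻¹)⁻¹ - a₀ * ((x + t⁻¹) ^ 2)⁻¹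
        + ∑ n ∈ Finset.Icc 1 N, a n * (n * (n + 1)) * ((x + t⁻¹) ^ (n + 2))⁻¹)
      + q * ((x + t⁻¹ - 1) ^ 2)⁻¹) := by
  have e1 : x + t⁻¹ = (1 + x * t) / t := by field_simp; ring
  have e2 : x + t⁻¹ - 1 = (1 + (x - 1) * t) / t := by field_simp; ring
  rw [e2, e1, inverseExpansion, neg_add, mul_add, mul_add, mul_neg t⁻¹ (∑ n ∈ _, _),
    Finset.mul_sum]
  have e3 : ∀ n : ℕ, a n * (n * (n + 1)) * (t ^ (n + 1) * ((1 + x * t)⁻¹) ^ (n + 2))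
      = t⁻¹ * (a n * (n * (n + 1)) * (((1 + x * t) / t) ^ (n + 2))⁻¹) := by
    intro n
    rw [div_pow, inv_div, inv_pow, pow_succ t (n + 1)]
    field_simp
  rw [Finset.sum_congr rfl fun n _ => e3 n]
  generalize (∑ n ∈ Finset.Icc 1 N, _ : ℂ) = S
  generalize 1 + x * t = v at h1 ⊢
  generalize 1 + (x - 1) * t = v' at h2 ⊢
  field_simp
  ring

theorem sub_inverseExpansion_isBigO (hL : IsPrimaryFunction L G Ξ q)
    (hG : HasStirlingExpansion G a₁ b₁ a₀ b₀ a) (x : ℂ) (N : ℕ) :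
    (fun t : ℝ => (t : ℂ) ^ (-1 : ℂ) • -deriv (logDeriv Ξ) (x + (t⁻¹ : ℝ))
        - inverseExpansion q a₁ a₀ a x N t) =O[𝓝[>] 0] fun t : ℝ => t ^ (N + 1) := by
  obtain ⟨ℓ, hd, he, hS⟩ := hG
  have h1 := deriv_logDeriv_G_isBigO hd he hL.order_G hS x N
  have h2 := hL.deriv_logDeriv_L_isBigO x (N + 2)
  have h3 := (h1.sub h2).comp_tendsto tendsto_inv_nhdsGT_zero
  have h4 : (fun t : ℝ => (t : ℂ)⁻¹) =O[𝓝[>] 0] fun t : ℝ => t⁻¹ :=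
    IsBigO.of_norm_norm (IsBigO.of_bound' (Eventually.of_forall fun t => by simp))
  refine (h4.mul h3).congr' ?_ ?_
  · have hre : ∀ᶠ t : ℝ in 𝓝[>] 0, 1 < (x + (t⁻¹ : ℝ)).re := by
      filter_upwards [tendsto_inv_nhdsGT_zero.eventually (eventually_gt_atTop (1 - x.re))]
        with t ht
      simp only [Complex.add_re, Complex.ofReal_re]
      linarith
    have hne : ∀ u : ℂ, ∀ᶠ t : ℝ in 𝓝[>] 0, 1 + u * (t : ℂ) ≠ 0 := fun u => by
      have hc : ContinuousAt (fun t : ℝ => 1 + u * (t : ℂ)) 0 := by fun_prop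
      exact (hc.eventually_ne (by simp)).filter_mono nhdsWithin_le_nhds
    filter_upwards [hre, hne x, hne (x - 1), self_mem_nhdsWithin] with t hret hx1 hx2 ht
    have ht0 : (t : ℂ) ≠ 0 := by exact_mod_cast (ne_of_gt ht)
    rw [inverseExpansion_eq ht0 hx1 hx2, hL.neg_deriv_logDeriv_Xi hret, Complex.cpow_neg_one]
    simp only [Function.comp_apply, Complex.ofReal_inv, smul_eq_mul]
    ring
  · filter_upwards [self_mem_nhdsWithin] with t ht
    have ht0 : t ≠ 0 := ne_of_gt ht
    simp only [Function.comp_apply, zpow_neg, zpow_natCast, inv_pow, inv_inv]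
    rw [pow_succ t (N + 1)]
    field_simp

/-- The expansion of `-t⁻¹ (Ξ'/Ξ)'(x + 1/t)` at `t = 0⁺`. Its constant term is `-a₁`, which becomes
the residue of `𝒵` at `s = 1`. -/
theorem exists_expansion_Xi (hL : IsPrimaryFunction L G Ξ q)
    (hG : HasStirlingExpansion G a₁ b₁ a₀ b₀ a) (x : ℂ) :
    ∃ c : ℕ → ℂ, c 0 = -a₁ ∧ ∀ N : ℕ,
      (fun t : ℝ => (t : ℂ) ^ (-1 : ℂ) • -deriv (logDeriv Ξ) (x + (t⁻¹ : ℝ))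
        - ∑ k ∈ Finset.range N, c k * (t : ℂ) ^ k) =O[𝓝[>] 0] fun t : ℝ => t ^ N := by
  obtain ⟨c, hc⟩ := exists_asymptotic_expansion
    (f := fun t : ℝ => (t : ℂ) ^ (-1 : ℂ) • -deriv (logDeriv Ξ) (x + (t⁻¹ : ℝ))) fun N =>
    ⟨inverseExpansion q a₁ a₀ a x N, analyticAt_inverseExpansion x N,
      (hL.sub_inverseExpansion_isBigO hG x N).trans (isBigO_pow_succ_pow N)⟩
  refine ⟨c, ?_, hc⟩
  have hz : Tendsto (fun t : ℝ => t ^ 1) (𝓝[>] 0) (𝓝 0) :=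
    tendsto_nhdsWithin_of_tendsto_nhds (by
      simpa using (continuous_pow (M := ℝ) 1).tendsto 0)
  have h1 := (hc 1).trans_tendsto hz
  have h2 := (hL.sub_inverseExpansion_isBigO hG x 0).trans_tendsto (by simpa using hz)
  have h3 : Tendsto (fun t : ℝ => inverseExpansion q a₁ a₀ a x 0 t) (𝓝[>] 0) (𝓝 (-a₁)) := by
    have hc : ContinuousAt (fun t : ℝ => inverseExpansion q a₁ a₀ a x 0 t) 0 := by
      refine ContinuousAt.comp (g := inverseExpansion q a₁ a₀ a x 0) ?_
        Complex.continuous_ofReal.continuousAt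
      simpa using (analyticAt_inverseExpansion x 0).continuousAt
    have := hc.tendsto
    rw [Complex.ofReal_zero, inverseExpansion_zero] at this
    exact tendsto_nhdsWithin_of_tendsto_nhds this
  have h4 := (h2.add h3).sub h1
  simp only [Finset.range_one, Finset.sum_singleton, pow_zero, mul_one, sub_add_cancel,
    sub_sub_cancel, zero_add, sub_zero] at h4
  exact tendsto_nhds_unique tendsto_const_nhds h4

section Continuation

variable (hL : IsPrimaryFunction L G Ξ q) {x : ℂ}
  (hx : ∀ ρ : ℂ, Ξ ρ = 0 → x - ρ ∈ Complex.slitPlane)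

include hL hx

theorem continuousAt_deriv_logDeriv_Xi_add {y : ℝ} (hy : 0 ≤ y) :
    ContinuousAt (fun y : ℝ => -deriv (logDeriv Ξ) (x + y)) y := by
  have hΞy : Ξ (x + y) ≠ 0 := fun h => neg_ofReal_notMem_slitPlane hy (by
    have := hx _ h
    rwa [show x - (x + y) = -(y : ℂ) by ring] at this)
  have h1 := hL.order_Xi.1.analyticAt (x + y)
  have h2 := (h1.deriv.div h1 hΞy).deriv.continuousAt
  have h3 : ContinuousAt (fun y : ℝ => x + (y : ℂ)) y := by fun_prop
  exact (ContinuousAt.comp (f := fun y : ℝ => x + (y : ℂ)) h2 h3).neg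

theorem locallyIntegrableOn_deriv_logDeriv_Xi_inv :
    MeasureTheory.LocallyIntegrableOn
      (fun t : ℝ => (t : ℂ) ^ (-1 : ℂ) • -deriv (logDeriv Ξ) (x + (t⁻¹ : ℝ))) (Set.Ioi 0) := by
  refine ContinuousOn.locallyIntegrableOn (fun t ht => ?_) measurableSet_Ioi
  have ht' : (0 : ℝ) < t := ht
  have h1 := hL.continuousAt_deriv_logDeriv_Xi_add hx (inv_pos.2 ht').le
  refine ContinuousAt.continuousWithinAt ?_
  exact (Complex.continuousAt_ofReal_cpow_const _ _ (Or.inr ht'.ne')).smul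
    (ContinuousAt.comp (f := fun t : ℝ => t⁻¹) h1 (continuousAt_inv₀ ht'.ne'))

theorem deriv_logDeriv_Xi_inv_isBigO_atTop :
    (fun t : ℝ => (t : ℂ) ^ (-1 : ℂ) • -deriv (logDeriv Ξ) (x + (t⁻¹ : ℝ)))
      =O[atTop] fun t : ℝ => t ^ (-1 : ℝ) := by
  have h1 := (hL.continuousAt_deriv_logDeriv_Xi_add hx le_rfl).tendsto.comp
    (tendsto_inv_atTop_zero (𝕜 := ℝ))
  have h2 : (fun t : ℝ => (t : ℂ) ^ (-1 : ℂ)) =O[atTop] fun t : ℝ => t ^ (-1 : ℝ) := by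
    refine IsBigO.of_bound 1 ?_
    filter_upwards [eventually_gt_atTop 0] with t ht
    rw [Complex.norm_cpow_eq_rpow_re_of_pos ht, Real.norm_of_nonneg (by positivity), one_mul]
    simp
  simpa using h2.smul (h1.isBigO_one ℝ)

/-- The meromorphic continuation of `𝒵`. The Mellin transform of the second logarithmic derivative
of `Ξ` has poles at `s = 1, 0, -1, …`, and all but the first are cancelled by the zeros of
`1 / Γ(s)`. -/
theorem exists_continuation_zeroZeta (hG : HasStirlingExpansion G a₁ b₁ a₀ b₀ a) :
    ∃ Z : ℂ → ℂ,
      MeromorphicOn Z Set.univ ∧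
      (∀ s : ℂ, 1 < s.re → Z s = zeroZeta Ξ s x) ∧
      (∀ s : ℂ, s ≠ 1 → AnalyticAt ℂ Z s) ∧
      HasSimplePolarPart Z 1 (-a₁) := by
  have hb := fun (a : ℝ) (ha : 1 < a) => hL.order_Xi.exists_norm_le ha
  have hre : ∀ ρ : ℂ, Ξ ρ = 0 → ρ.re < 1 := fun ρ hρ => (hL.zeros_Xi ρ hρ).2
  obtain ⟨c, hc0, hc⟩ := hL.exists_expansion_Xi hG x
  obtain ⟨F, hF⟩ := exists_mellin_continuation (hL.locallyIntegrableOn_deriv_logDeriv_Xi_inv hx) hc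
  obtain ⟨hF1, hF2, hF3⟩ := hF 1 (hL.deriv_logDeriv_Xi_inv_isBigO_atTop hx)
  set u : ℂ → ℂ := fun s => (Complex.Gamma (2 - s))⁻¹ * (Complex.Gamma s)⁻¹ with hu
  have hudiff : Differentiable ℂ u := by
    have h1 : Differentiable ℂ fun s : ℂ => (Complex.Gamma (2 - s))⁻¹ :=
      Complex.differentiable_one_div_Gamma.comp (by fun_prop : Differentiable ℂ fun s : ℂ => 2 - s)
    exact h1.mul Complex.differentiable_one_div_Gamma
  set R : ℂ → ℂ := fun s => F (s - 1) * u s with hR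
  have hagree : ∀ s : ℂ, 1 < s.re → s.re < 2 → R s = zeroZeta Ξ s x := by
    intro s hs hs2
    have h1 := mellin_deriv_logDeriv_eq hL.order_Xi.1 hL.Xi_zero_ne_zero hb hx hre hs hs2
    have h2 : F (s - 1) = mellin (fun y : ℝ => -deriv (logDeriv Ξ) (x + y)) (2 - s) := by
      rw [hF1 (s - 1) (by simpa using hs) (by simp; linarith), mellin_cpow_smul,
        mellin_comp_inv (fun y : ℝ => -deriv (logDeriv Ξ) (x + y))]
      congr 1
      ring
    have h3 : Complex.Gamma (2 - s) ≠ 0 := Complex.Gamma_ne_zero_of_re_pos (by simpa using hs2)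
    have h4 : Complex.Gamma s ≠ 0 := Complex.Gamma_ne_zero_of_re_pos (by linarith)
    simp only [hR, hu, h2, h1]
    field_simp
  have hpol : ∀ k : ℕ, HasSimplePolarPart R (-(k : ℂ) + 1) (c k * u (-(k : ℂ) + 1)) := fun k =>
    ((hF3 k (by have : (0 : ℝ) ≤ k := Nat.cast_nonneg k
                linarith)).comp_sub_const 1).mul_analyticAt (hudiff.analyticAt _)
  have hRan : ∀ s : ℂ, s.re < 2 → (∀ k : ℕ, s ≠ -(k : ℂ) + 1) → AnalyticAt ℂ R s := by
    intro s hs2 hs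
    refine AnalyticAt.mul (AnalyticAt.comp (f := fun s : ℂ => s - 1)
      (hF2 _ (by simp; linarith) fun k hk => hs k (by linear_combination hk)) (by fun_prop))
      (hudiff.analyticAt s)
  classical
  set Z₀ : ℂ → ℂ := fun s => if 1 < s.re then zeroZeta Ξ s x else R s with hZ₀
  have hZ₀R : ∀ s : ℂ, s.re < 2 → Z₀ =ᶠ[𝓝 s] R := by
    intro s hs
    filter_upwards [(isOpen_lt Complex.continuous_re continuous_const).mem_nhds hs] with w hw
    by_cases h : 1 < w.re
    · simp only [hZ₀, if_pos h, hagree w h hw]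
    · simp only [hZ₀, if_neg h]
  have hZ₀an : ∀ s : ℂ, 1 < s.re → AnalyticAt ℂ Z₀ s := by
    intro s hs
    refine (analyticAt_zeroZeta hL.order_Xi.1 hL.Xi_zero_ne_zero hb hx hs).congr ?_
    filter_upwards [(isOpen_lt continuous_const Complex.continuous_re).mem_nhds hs] with w hw
    have hw' : 1 < w.re := hw
    simp only [hZ₀, if_pos hw']
  have hZ₀pol : ∀ k : ℕ, HasSimplePolarPart Z₀ (-(k : ℂ) + 1) (c k * u (-(k : ℂ) + 1)) :=
    fun k => (hpol k).congr ((hZ₀R _ (by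
      have : (0 : ℝ) ≤ k := Nat.cast_nonneg k
      simp
      linarith)).symm.filter_mono nhdsWithin_le_nhds)
  have hpol1 : HasSimplePolarPart Z₀ 1 (-a₁) := by
    have h := hZ₀pol 0
    have e : u 1 = 1 := by
      simp only [hu, show (2 : ℂ) - 1 = 1 by norm_num, Complex.Gamma_one, inv_one, mul_one]
    simpa [hc0, e] using h
  obtain ⟨Z, hZm, hZf, hZan, hZ1⟩ := exists_meromorphic_of_hasSimplePolarPart hpol1 (by
    intro s hs
    by_cases h1 : 1 < s.re
    · exact Or.inl (hZ₀an s h1)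
    · have h2 : s.re < 2 := by linarith
      by_cases hk : ∃ k : ℕ, s = -(k : ℂ) + 1
      · obtain ⟨k, rfl⟩ := hk
        obtain ⟨j, rfl⟩ : ∃ j, k = j + 1 := Nat.exists_eq_succ_of_ne_zero (by
          rintro rfl
          simp at hs)
        right
        have h := hZ₀pol (j + 1)
        have e : u (-((j + 1 : ℕ) : ℂ) + 1) = 0 := by
          have : (-((j + 1 : ℕ) : ℂ) + 1) = -(j : ℂ) := by push_cast; ring
          simp only [hu, this, Complex.Gamma_neg_nat_eq_zero, inv_zero, mul_zero]
        rwa [e, mul_zero] at h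
      · push Not at hk
        exact Or.inl ((hRan s h2 hk).congr (hZ₀R s h2).symm))
  refine ⟨Z, hZm, fun s hs => ?_, hZan, hZ1⟩
  rw [hZf s (hZ₀an s hs)]
  simp only [hZ₀, if_pos hs]

end Continuation

end IsPrimaryFunction

/-! ### The two continuations -/

theorem mainTheorem2 (L G Ξ : ℂ → ℂ) (q : ℕ) (hL : IsPrimaryFunction L G Ξ q)
    (a₁ b₁ a₀ b₀ : ℂ) (a : ℕ → ℂ) (hG : HasStirlingExpansion G a₁ b₁ a₀ b₀ a) :
    -- meromorphic continuation of `𝒥(s, x)`, its poles and residues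
    (∀ x : ℂ, x - 1 ∈ Complex.slitPlane → (∀ z : ℂ, L z = 0 → x - z ∈ Complex.slitPlane) →
      (∀ s : ℂ, s.re < 1 →
        MeasureTheory.IntegrableOn (mellinIntegrand L s x) (Set.Ioi (0 : ℝ))) ∧
      ∃ J : ℂ → ℂ,
        MeromorphicOn J Set.univ ∧
        (∀ s : ℂ, s.re < 1 → J s = mellinJ L s x) ∧
        (∀ s : ℂ, (∀ n : ℕ, 1 ≤ n → s ≠ (n : ℂ)) → AnalyticAt ℂ J s) ∧
        (∀ n : ℕ, 1 ≤ n →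
          HasSimplePolarPart J (n : ℂ) (-logDerivN L n x / ((n - 1).factorial : ℂ))) ∧
        (∀ n : ℕ, 1 ≤ n → logDerivN L n x ≠ 0 → meromorphicOrderAt J (n : ℂ) = -1)) ∧
    -- for `L` real on the real axis and `x` real, the derivatives above are those of `log |L|`
    ((∀ t : ℝ, 1 < t → (L (t : ℂ)).im = 0) →
      ∀ n : ℕ, 1 ≤ n → ∀ t : ℝ, 1 < t →
        logDerivN L n (t : ℂ)
          = ((iteratedDeriv n (fun u : ℝ => Real.log ‖L (u : ℂ)‖) t : ℝ) : ℂ)) ∧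
    -- meromorphic continuation of `𝒵(s, x)`, its only pole and residue
    (∀ x : ℂ, (∀ ρ : ℂ, Ξ ρ = 0 → x - ρ ∈ Complex.slitPlane) →
      (∀ s : ℂ, 1 < s.re → Summable (zeroZetaTerm Ξ s x)) ∧
      ∃ Z : ℂ → ℂ,
        MeromorphicOn Z Set.univ ∧
        (∀ s : ℂ, 1 < s.re → Z s = zeroZeta Ξ s x) ∧
        (∀ s : ℂ, s ≠ 1 → AnalyticAt ℂ Z s) ∧
        HasSimplePolarPart Z 1 (-a₁) ∧
        (a₁ ≠ 0 → meromorphicOrderAt Z 1 = -1)) := by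
  refine ⟨fun x hx1 hxL => ⟨fun s hs => hL.integrableOn_mellinIntegrand hx1 hxL hs,
    hL.exists_continuation_mellinJ hx1 hxL⟩,
    fun hreal n hn t ht => hL.logDerivN_ofReal hreal hn ht, fun x hx => ⟨fun s hs => ?_, ?_⟩⟩
  · exact summable_zeroZetaTerm hL.order_Xi.1 hL.Xi_zero_ne_zero
      (fun a ha => hL.order_Xi.exists_norm_le ha) hx hs
  · obtain ⟨Z, hZm, hZ, hZan, hZ1⟩ := hL.exists_continuation_zeroZeta hx hG
    exact ⟨Z, hZm, hZ, hZan, hZ1, fun h => hZ1.meromorphicOrderAt_eq (neg_ne_zero.2 h)⟩
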